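/- Let $k$ be an algebraically closed field and let $n \ge 2$ be an integer. Write $\mathbb A(2,d)$ for the affine space of ternary forms of degree $d$ over $k$. Let $V_n$ be the vector bundle on $\mathbb A(2,2)\setminus\{0\}$ whose fibre at $q$ is $\mathbb A(2,n)/q\cdot\mathbb A(2,n-2)$, and let $\mathbb P(V_n)$ be its projectivization, whose points are the pairs $(q,[f])$ with $q\neq 0$ and $[f]$ a line in the fibre at $q$. The group $\mathrm{GL}_3$ acts on it by $A\cdot(q,[f])=(\det(A)\,q(A^{-1}x),[f(A^{-1}x)])$. For forms $g,f$, call a point $u\in\mathbb P^2$ a singular point of $V_+(g,f)$ if $g(u)=f(u)=0$ and the $2\times 3$ jacobian matrix of $(g,f)$ at $u$ has rank less than $2$; call $V_+(g,f)$ singular if it has a singular point. Let $D\subset\mathbb P(V_n)$ be the locus of the $(q,[f])$ such that $V_+(q,f)$ is singular, with its reduced structure. Let $\mathbb P(V_n)_{\rm nod}$ and $D_{\rm nod}$ be the restrictions of $\mathbb P(V_n)$ and $D$ to the locus of nodal conics $q=l_1l_2$, where $l_1,l_2$ are linear forms defining distinct lines. Put $$D^1_{\rm nod}=\{(l_1l_2,[f])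 : V_+(l_1,l_2,f)\neq\emptyset\},\qquad D^2_{\rm nod}=\{(l_1l_2,[f]) : V_+(l_i,f)\text{ is singular for some } i\}.$$ Then $D_{\rm nod}$ is closed in $\mathbb P(V_n)_{\rm nod}$ and has exactly two irreducible components, which are $D^1_{\rm nod}$ and $D^2_{\rm nod}$. Both are $\mathrm{GL}_3$-invariant and of codimension $1$ in $\mathbb P(V_n)_{\rm nod}$. -/

import Mathlib

open MvPolynomial
open scoped LinearAlgebra.Projectivization Matrix

namespace TernaryForms

/-! ### The Zariski topology on the points of an affine space -/

section Zariski

variable (k : Type*) [Field k] (E : Type*) [AddCommGroup E] [Module k E]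

/-- The polynomial function on the vector space `E` given by a polynomial `P` whose variables are
the linear forms on `E`. -/
noncomputable def polyFun (P : MvPolynomial (Module.Dual k E) k) (x : E) : k :=
  eval (fun φ : Module.Dual k E => φ x) P

/-- The Zariski topology on the vector space `E`: the closed sets are the common zero loci of
sets of polynomial functions. -/
@[reducible] def zariski : TopologicalSpace E :=
  TopologicalSpace.ofClosed
    {Z | ∃ S : Set (MvPolynomial (Module.Dual k E) k), Z = {x | ∀ P ∈ S, polyFun k E P x = 0}}
    ⟨{1}, by ext x; simp [polyFun]⟩
    (by
      intro A hA
      have hA' : ∀ Z ∈ A, ∃ S : Set (MvPolynomial (Module.Dual k E) k),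
          Z = {x | ∀ P ∈ S, polyFun k E P x = 0} := fun Z hZ => hA hZ
      choose! S hS using hA'
      refine ⟨⋃ Z ∈ A, S Z, ?_⟩
      ext x
      simp only [Set.mem_sInter, Set.mem_iUnion, Set.mem_ofPred_eq, exists_prop]
      constructor
      · rintro h P ⟨Z, hZ, hP⟩
        have := h Z hZ
        rw [hS Z hZ] at this
        exact this P hP
      · intro h Z hZ
        rw [hS Z hZ]
        exact fun P hP => h P ⟨Z, hZ, hP⟩)
    (by
      rintro _ ⟨S, rfl⟩ _ ⟨T, rfl⟩
      refine ⟨{R | ∃ P ∈ S, ∃ Q ∈ T, R = P * Q}, ?_⟩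
      ext x
      simp only [Set.mem_union, Set.mem_ofPred_eq]
      constructor
      · rintro (h | h) _ ⟨P, hP, Q, hQ, rfl⟩
        · have := h P hP
          simp only [polyFun, map_mul] at this ⊢
          rw [this, zero_mul]
        · have := h Q hQ
          simp only [polyFun, map_mul] at this ⊢
          rw [this, mul_zero]
      · intro h
        by_contra! hc
        obtain ⟨⟨P, hP, hP0⟩, ⟨Q, hQ, hQ0⟩⟩ := hc
        have := h _ ⟨P, hP, Q, hQ, rfl⟩
        simp only [polyFun, map_mul] at this hP0 hQ0
        exact (mul_ne_zero hP0 hQ0) this)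

end Zariski

/-- Codimension of subsets: `Z` is an irreducible closed subset of `X`, and `c` is the supremum of
the lengths of the chains `Z = Z₀ ⊂ Z₁ ⊂ ⋯` of irreducible closed subsets of `X`. -/
def HasCodim {X : Type*} [TopologicalSpace X] (Z : Set X) (c : ℕ∞) : Prop :=
  ∃ T : TopologicalSpace.IrreducibleCloseds X, (T : Set X) = Z ∧ Order.coheight T = c

/-! ### Ternary forms, the bundle `V_n` and its projectivization -/

section Bundle

variable (k : Type*) [Field k]

/-- `𝔸(2,d)`: the space of ternary forms of degree `d` (including zero). -/
abbrev Form (d : ℕ) : Submodule k (MvPolynomial (Fin 3) k) :=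
  homogeneousSubmodule (Fin 3) k d

variable {k}

/-- The image of `𝔸(2,n-2) → 𝔸(2,n)`, `g ↦ g q`. -/
noncomputable def multiples (n : ℕ) (q : Form k 2) : Submodule k (Form k n) :=
  ((Form k (n - 2)).map (LinearMap.mulRight k (q : MvPolynomial (Fin 3) k))).comap
    (Form k n).subtype

/-- The fibre of `V_n` at the quadratic form `q`. -/
abbrev Fiber (n : ℕ) (q : Form k 2) : Type _ := Form k n ⧸ multiples n q

variable (k)

/-- The (closed) points of `ℙ(V_n)`: a nonzero quadratic form `q` and a line `[f]` in the fibre of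
`V_n` at `q`. -/
def PV (n : ℕ) : Type _ := Σ q : {q : Form k 2 // q ≠ 0}, ℙ k (Fiber n q.1)

/-- Pairs `(q, f)` with `q ≠ 0` such that the class of `f` in the fibre of `V_n` is not zero. -/
def Pairs (n : ℕ) : Type _ :=
  {p : Form k 2 × Form k n // p.1 ≠ 0 ∧ p.2 ∉ multiples n p.1}

/-- `Pairs k n` is an open subset of the affine space `𝔸(2,2) × 𝔸(2,n)`. -/
noncomputable instance (n : ℕ) : TopologicalSpace (Pairs k n) :=
  TopologicalSpace.induced Subtype.val (zariski k (Form k 2 × Form k n))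

variable {k}

/-- The projection `(q, f) ↦ (q, [f])`. -/
noncomputable def proj {n : ℕ} (p : Pairs k n) : PV k n :=
  ⟨⟨p.1.1, p.2.1⟩, Projectivization.mk k (Submodule.Quotient.mk p.1.2)
    (fun h => p.2.2 ((Submodule.Quotient.mk_eq_zero _).1 h))⟩

/-- The Zariski topology of `ℙ(V_n)`. The projection from the variety of pairs is a smooth
surjection, hence a topological quotient map. -/
noncomputable instance (n : ℕ) : TopologicalSpace (PV k n) :=
  TopologicalSpace.coinduced proj inferInstance

/-- Nodal quadratic forms: the products of two linear forms which define distinct lines. -/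
def IsNodal (q : Form k 2) : Prop :=
  ∃ l₁ l₂ : Form k 1, LinearIndependent k ![l₁, l₂] ∧
    (q : MvPolynomial (Fin 3) k) = (l₁ : MvPolynomial (Fin 3) k) * l₂

variable (k) in
/-- `ℙ(V_n)_nod`, the restriction of `ℙ(V_n)` to the nodal quadratic forms (with the subspace
topology). -/
abbrev PVnod (n : ℕ) : Type _ := {x : PV k n // IsNodal x.1.1}

/-! ### The action of `GL₃` -/

/-- The substitution `f(x) ↦ f(A⁻¹ x)`. -/
noncomputable def subst (A : GL (Fin 3) k) :
    MvPolynomial (Fin 3) k →ₐ[k] MvPolynomial (Fin 3) k :=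
  aeval fun i => ∑ j, C ((A⁻¹ : GL (Fin 3) k).1 i j) * X j

lemma subst_one (f : MvPolynomial (Fin 3) k) : subst (1 : GL (Fin 3) k) f = f := by
  have : subst (1 : GL (Fin 3) k) = AlgHom.id k _ := by
    ext i : 1
    simp [subst, Matrix.one_apply]
  rw [this]; rfl

lemma subst_mul (A B : GL (Fin 3) k) (f : MvPolynomial (Fin 3) k) :
    subst (A * B) f = subst A (subst B f) := by
  have : subst (A * B) = (subst A).comp (subst B) := by
    ext i : 1
    simp only [subst, mul_inv_rev, aeval_X, AlgHom.comp_apply, map_sum, map_mul, algHom_C,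
      Units.val_mul, Matrix.mul_apply, Finset.sum_mul, Finset.mul_sum, algebraMap_eq]
    rw [Finset.sum_comm]
    simp only [mul_assoc]
  rw [this]; rfl

lemma subst_mem (A : GL (Fin 3) k) {d : ℕ} {f : MvPolynomial (Fin 3) k} (hf : f ∈ Form k d) :
    subst A f ∈ Form k d := by
  have h := IsHomogeneous.aeval ((mem_homogeneousSubmodule d f).1 hf)
    (fun i => ∑ j, C ((A⁻¹ : GL (Fin 3) k).1 i j) * X j) (n := 1)
    (fun i => IsHomogeneous.sum _ _ _ fun j _ => isHomogeneous_C_mul_X _ _)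
  rw [one_mul] at h
  exact h

/-- `f(x) ↦ f(A⁻¹ x)` on forms of degree `d`. -/
noncomputable def substForm (A : GL (Fin 3) k) (d : ℕ) : Form k d →ₗ[k] Form k d :=
  (subst A).toLinearMap.restrict fun _ hf => subst_mem A hf

@[simp] lemma coe_substForm (A : GL (Fin 3) k) (d : ℕ) (f : Form k d) :
    (substForm A d f : MvPolynomial (Fin 3) k) = subst A f := rfl

lemma substForm_one (d : ℕ) (f : Form k d) : substForm (1 : GL (Fin 3) k) d f = f :=
  Subtype.ext (subst_one _)

lemma substForm_mul (A B : GL (Fin 3) k) (d : ℕ) (f : Form k d) :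
    substForm (A * B) d f = substForm A d (substForm B d f) :=
  Subtype.ext (subst_mul _ _ _)

lemma substForm_inv_apply (A : GL (Fin 3) k) (d : ℕ) (f : Form k d) :
    substForm A⁻¹ d (substForm A d f) = f := by
  rw [← substForm_mul, inv_mul_cancel, substForm_one]

lemma substForm_injective (A : GL (Fin 3) k) (d : ℕ) : Function.Injective (substForm A d) :=
  Function.LeftInverse.injective (substForm_inv_apply A d)

/-- The action `q(x) ↦ det(A) q(A⁻¹ x)` on quadratic forms. -/
noncomputable def actQuad (A : GL (Fin 3) k) (q : Form k 2) : Form k 2 :=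
  (A : Matrix (Fin 3) (Fin 3) k).det • substForm A 2 q

lemma det_ne_zero (A : GL (Fin 3) k) : (A : Matrix (Fin 3) (Fin 3) k).det ≠ 0 :=
  ((Matrix.isUnit_iff_isUnit_det _).1 A.isUnit).ne_zero

lemma actQuad_one (q : Form k 2) : actQuad (1 : GL (Fin 3) k) q = q := by
  simp [actQuad, substForm_one]

lemma actQuad_mul (A B : GL (Fin 3) k) (q : Form k 2) :
    actQuad (A * B) q = actQuad A (actQuad B q) := by
  simp [actQuad, substForm_mul, smul_smul]

lemma actQuad_ne_zero (A : GL (Fin 3) k) {q : Form k 2} (hq : q ≠ 0) : actQuad A q ≠ 0 :=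
  smul_ne_zero (det_ne_zero A) fun h => hq (substForm_injective A 2 (h.trans (map_zero _).symm))

lemma substForm_mem_multiples (A : GL (Fin 3) k) {n : ℕ} {q : Form k 2} {f : Form k n}
    (hf : f ∈ multiples n q) : substForm A n f ∈ multiples n (actQuad A q) := by
  obtain ⟨g, hg, hgf⟩ := hf
  refine ⟨(A : Matrix (Fin 3) (Fin 3) k).det⁻¹ • subst A g,
    Submodule.smul_mem _ _ (subst_mem A hg), ?_⟩
  have hgf' : g * (q : MvPolynomial (Fin 3) k) = f := hgf
  change (_ • subst A g) * ((actQuad A q : Form k 2) : MvPolynomial (Fin 3) k) = subst A f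
  simp only [actQuad, Submodule.coe_smul, coe_substForm, smul_mul_smul_comm,
    inv_mul_cancel₀ (det_ne_zero A), one_smul, ← hgf', map_mul]

lemma substForm_mem_multiples_iff (A : GL (Fin 3) k) {n : ℕ} {q : Form k 2} {f : Form k n} :
    substForm A n f ∈ multiples n (actQuad A q) ↔ f ∈ multiples n q := by
  refine ⟨fun h => ?_, substForm_mem_multiples A⟩
  have := substForm_mem_multiples A⁻¹ h
  rwa [substForm_inv_apply, ← actQuad_mul, inv_mul_cancel, actQuad_one] at this

/-- The isomorphism between the fibres of `V_n` at `q` and at `A • q` induced by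
`f(x) ↦ f(A⁻¹ x)`. -/
noncomputable def fiberMap (A : GL (Fin 3) k) (n : ℕ) (q : Form k 2) :
    Fiber n q →ₗ[k] Fiber n (actQuad A q) :=
  Submodule.mapQ _ _ (substForm A n) fun _ hf => substForm_mem_multiples A hf

lemma fiberMap_injective (A : GL (Fin 3) k) (n : ℕ) (q : Form k 2) :
    Function.Injective (fiberMap A n q) := by
  rw [injective_iff_map_eq_zero]
  intro x hx
  induction x using Submodule.Quotient.induction_on with
  | _ f =>
    rw [fiberMap, Submodule.mapQ_apply, Submodule.Quotient.mk_eq_zero,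
      substForm_mem_multiples_iff] at hx
    exact (Submodule.Quotient.mk_eq_zero _).2 hx

/-- `A • (q(x), [f(x)]) = (det(A) q(A⁻¹ x), [f(A⁻¹ x)])`. -/
noncomputable instance (n : ℕ) : SMul (GL (Fin 3) k) (PV k n) where
  smul A x := ⟨⟨actQuad A x.1.1, actQuad_ne_zero A x.1.2⟩,
    Projectivization.map (fiberMap A n x.1.1) (fiberMap_injective A n x.1.1) x.2⟩

/-- `A • (q(x), f(x)) = (det(A) q(A⁻¹ x), f(A⁻¹ x))` on pairs. -/
noncomputable instance (n : ℕ) : SMul (GL (Fin 3) k) (Pairs k n) where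
  smul A p := ⟨(actQuad A p.1.1, substForm A n p.1.2), actQuad_ne_zero A p.2.1,
    fun h => p.2.2 ((substForm_mem_multiples_iff A).1 h)⟩

lemma smul_proj {n : ℕ} (A : GL (Fin 3) k) (p : Pairs k n) : A • proj p = proj (A • p) := rfl

lemma proj_surjective (n : ℕ) : Function.Surjective (proj : Pairs k n → PV k n) := by
  rintro ⟨⟨q, hq⟩, x⟩
  induction x using Projectivization.ind with
  | _ v hv =>
    obtain ⟨f, rfl⟩ := Submodule.Quotient.mk_surjective _ v
    exact ⟨⟨(q, f), hq, fun h => hv ((Submodule.Quotient.mk_eq_zero _).2 h)⟩, rfl⟩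

noncomputable instance (n : ℕ) : MulAction (GL (Fin 3) k) (PV k n) where
  one_smul x := by
    obtain ⟨p, rfl⟩ := proj_surjective n x
    rw [smul_proj]
    exact congrArg proj (Subtype.ext (Prod.ext (actQuad_one _) (substForm_one _ _)))
  mul_smul A B x := by
    obtain ⟨p, rfl⟩ := proj_surjective n x
    simp only [smul_proj]
    exact congrArg proj (Subtype.ext (Prod.ext (actQuad_mul _ _ _) (substForm_mul _ _ _ _)))

lemma IsNodal.actQuad (A : GL (Fin 3) k) {q : Form k 2} (hq : IsNodal q) :
    IsNodal (actQuad A q) := by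
  obtain ⟨l₁, l₂, hl, h⟩ := hq
  have hA := det_ne_zero A
  refine ⟨(A : Matrix (Fin 3) (Fin 3) k).det • substForm A 1 l₁, substForm A 1 l₂, ?_, ?_⟩
  · rw [LinearIndependent.pair_iff] at hl ⊢
    intro s t hst
    rw [smul_smul, ← map_smul, ← map_smul, ← map_add] at hst
    have := hl _ _ (substForm_injective A 1 (hst.trans (map_zero _).symm))
    exact ⟨(mul_eq_zero.1 this.1).resolve_right hA, this.2⟩
  · simp [TernaryForms.actQuad, h]

noncomputable instance (n : ℕ) : MulAction (GL (Fin 3) k) (PVnod k n) where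
  smul A x := ⟨A • x.1, x.2.actQuad A⟩
  one_smul x := Subtype.ext (one_smul _ x.1)
  mul_smul A B x := Subtype.ext (mul_smul A B x.1)

/-! ### The divisor `D_nod` and the loci `D¹_nod`, `D²_nod` -/

/-- The jacobian matrix of `g` and `f` at `u`. -/
noncomputable def jacobian (g f : MvPolynomial (Fin 3) k) (u : Fin 3 → k) :
    Matrix (Fin 2) (Fin 3) k :=
  Matrix.of ![fun j => eval u (pderiv j g), fun j => eval u (pderiv j f)]

/-- `u` is a singular point of the subscheme `V₊(g, f)` of the plane, in the sense of the
jacobian criterion: `g` and `f` vanish at `u`, and so do the three minors of order two of the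
jacobian matrix (the `i`-th one is obtained by removing the `i`-th column). -/
def IsSingularAt (g f : MvPolynomial (Fin 3) k) (u : Fin 3 → k) : Prop :=
  eval u g = 0 ∧ eval u f = 0 ∧
    ∀ i : Fin 3, ((jacobian g f u).submatrix id i.succAbove).det = 0

/-- `V₊(g, f)` has a singular point in the projective plane. -/
def IsSingularPair (g f : MvPolynomial (Fin 3) k) : Prop :=
  ∃ u : Fin 3 → k, u ≠ 0 ∧ IsSingularAt g f u

variable (k)

/-- The fundamental divisor `D`: the image in `ℙ(V_n)` of the pairs `(q, f)` such that `V₊(q, f)`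
is singular. -/
def D (n : ℕ) : Set (PV k n) :=
  proj '' {p : Pairs k n | IsSingularPair (p.1.1 : MvPolynomial (Fin 3) k) p.1.2}

/-- The restriction of `D` to the nodal conics. -/
def Dnod (n : ℕ) : Set (PVnod k n) := Subtype.val ⁻¹' D k n

/-- `D¹_nod`: the points `(l₁ l₂, [f])` such that `V₊(l₁, l₂, f)` is not empty. -/
def D1nod (n : ℕ) : Set (PVnod k n) :=
  {x | ∃ p : Pairs k n, proj p = x.1 ∧ ∃ l₁ l₂ : Form k 1,
    (p.1.1 : MvPolynomial (Fin 3) k) = (l₁ : MvPolynomial (Fin 3) k) * l₂ ∧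
    ∃ u : Fin 3 → k, u ≠ 0 ∧ eval u (l₁ : MvPolynomial (Fin 3) k) = 0 ∧
      eval u (l₂ : MvPolynomial (Fin 3) k) = 0 ∧ eval u (p.1.2 : MvPolynomial (Fin 3) k) = 0}

/-- `D²_nod`: the points `(l₁ l₂, [f])` such that `V₊(lᵢ, f)` is singular for some `i`. -/
def D2nod (n : ℕ) : Set (PVnod k n) :=
  {x | ∃ p : Pairs k n, proj p = x.1 ∧ ∃ l₁ l₂ : Form k 1,
    (p.1.1 : MvPolynomial (Fin 3) k) = (l₁ : MvPolynomial (Fin 3) k) * l₂ ∧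
    (IsSingularPair (l₁ : MvPolynomial (Fin 3) k) p.1.2 ∨
      IsSingularPair (l₂ : MvPolynomial (Fin 3) k) p.1.2)}

end Bundle

end TernaryForms

/-! The space `PVnod` is studied through the map `Triples.point`, which sends `(l₁, l₂, f)` to `(l₁
l₂, [f])`. Its source `Triples` is an open subset of an affine space, so it is irreducible, and
everything follows once the map is known to be continuous, surjective and open
(`Triples.isOpenMap_point`): closedness can then be tested upstairs and irreducibility passes to
images.

Openness is the delicate point, because `PVnod` carries the topology of a subspace of a quotient.
Two triples over the same point differ by a polynomial automorphism over `PVnod` (rescaling and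
exchanging the lines, scaling `f`, adding multiples of `l₁ l₂`), since factorization into linear
forms is unique. Hence saturations of open sets are open, and it remains to see that saturated
closed sets have closed images. For this the closure in the whole affine space is pushed forward to
the pairs `(q, f)` by elimination theory. `isClosed_elimination` rests on the Nullstellensatz: a
conic set whose fibre over `x` has no nonzero vector forces all monomials of some degree `N` into
the specialized ideal, and the nonvanishing of a determinant preserves this near `x`.

The decomposition of the singular locus is the product rule. At a point of `l₁ = 0` the gradient of
`l₁ l₂` is `l₂(u)` times that of `l₁`; so the node is singular as soon as `f` passes through it, and
any other singular point is one of `V₊(lᵢ, f)`.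

Upstairs, the first locus is given by `f = l₁ h + l₂ g`, or by the single equation `f(l₁ × l₂) = 0`.
Exchanging the lines shows that the second locus is the image of the triples with `f = m² g + l₁ h`;
on a suitable open set these are the zeros of the discriminant of `f` restricted to `l₁`. The
parametrizations give irreducibility and the equations give codimension one: near a general point of
an irreducible hypersurface `H`, the zeros of any nonzero polynomial lie in `H`
(`exists_isPolyFun_hypersurface`), so no irreducible closed set lies strictly between the locus and
the whole space. Finally, `nodeTriple` and `tangentTriple` show that neither locus contains the
other, in every characteristic. -/

namespace TernaryForms

/-! ### Polynomial functions and the Zariski topology -/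

section PolynomialFunctions

variable {k : Type*} [Field k] {E F : Type*} [AddCommGroup E] [Module k E]
  [AddCommGroup F] [Module k F]

/-- The vector space `E` as a topological space, with the Zariski topology. -/
def Aff (k E : Type*) [Field k] [AddCommGroup E] [Module k E] : Type _ := E

instance : TopologicalSpace (Aff k E) := zariski k E

/-- Polynomial functions on a vector space. -/
def IsPolyFun (f : E → k) : Prop :=
  ∃ P : MvPolynomial (Module.Dual k E) k, ∀ x, polyFun k E P x = f x

/-- Polynomial maps between vector spaces. -/
def IsPolyMap (u : E → F) : Prop := ∀ φ : Module.Dual k F, IsPolyFun fun x => φ (u x)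

namespace IsPolyFun

lemma of_polyFun (P : MvPolynomial (Module.Dual k E) k) : IsPolyFun (polyFun k E P) :=
  ⟨P, fun _ => rfl⟩

lemma const (c : k) : IsPolyFun fun _ : E => c := ⟨C c, fun x => by simp [polyFun]⟩

lemma linear (φ : Module.Dual k E) : IsPolyFun fun x => φ x := ⟨X φ, fun x => by simp [polyFun]⟩

variable {f g : E → k}

lemma add (hf : IsPolyFun f) (hg : IsPolyFun g) : IsPolyFun fun x => f x + g x := by
  obtain ⟨P, hP⟩ := hf
  obtain ⟨Q, hQ⟩ := hg
  exact ⟨P + Q, fun x => by beta_reduce; rw [← hP, ← hQ, polyFun, map_add]; rfl⟩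

lemma mul (hf : IsPolyFun f) (hg : IsPolyFun g) : IsPolyFun fun x => f x * g x := by
  obtain ⟨P, hP⟩ := hf
  obtain ⟨Q, hQ⟩ := hg
  exact ⟨P * Q, fun x => by beta_reduce; rw [← hP, ← hQ, polyFun, map_mul]; rfl⟩

lemma neg (hf : IsPolyFun f) : IsPolyFun fun x => -f x := by
  simpa using (const (-1)).mul hf

lemma sub (hf : IsPolyFun f) (hg : IsPolyFun g) : IsPolyFun fun x => f x - g x := by
  simpa [sub_eq_add_neg] using hf.add hg.neg

lemma pow (hf : IsPolyFun f) (n : ℕ) : IsPolyFun fun x => f x ^ n := by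
  obtain ⟨P, hP⟩ := hf
  exact ⟨P ^ n, fun x => by beta_reduce; rw [← hP, polyFun, map_pow]; rfl⟩

lemma sum {ι : Type*} (s : Finset ι) {f : ι → E → k} (hf : ∀ i ∈ s, IsPolyFun (f i)) :
    IsPolyFun fun x => ∑ i ∈ s, f i x := by
  classical
  induction s using Finset.induction_on with
  | empty => simpa using const 0
  | insert a s ha ih =>
    simp only [Finset.sum_insert ha]
    exact (hf a (by simp)).add (ih fun i hi => hf i (by simp [hi]))

lemma comp {f : F → k} (hf : IsPolyFun f) {u : E → F} (hu : IsPolyMap (k := k) u) :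
    IsPolyFun fun x => f (u x) := by
  choose Q hQ using hu
  obtain ⟨P, hP⟩ := hf
  refine ⟨bind₁ Q P, fun x => ?_⟩
  beta_reduce
  rw [← hP, polyFun, polyFun]
  induction P using MvPolynomial.induction_on generalizing f with
  | C a => simp
  | add p q hp hq =>
    simp only [map_add]
    rw [hp fun _ => rfl, hq fun _ => rfl]
  | mul_X p φ hp =>
    simp only [map_mul, bind₁_X_right, eval_X]
    rw [hp fun _ => rfl]
    exact congrArg _ (hQ φ x)

/-- The restriction of a polynomial function to a line. -/
lemma exists_polynomial (hf : IsPolyFun f) (x v : E) :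
    ∃ p : Polynomial k, ∀ t : k, p.eval t = f (x + t • v) := by
  obtain ⟨P, hP⟩ := hf
  simp only [← hP, polyFun]
  clear hP
  induction P using MvPolynomial.induction_on with
  | C a => exact ⟨Polynomial.C a, fun t => by simp⟩
  | add p q hp hq =>
    obtain ⟨a, ha⟩ := hp
    obtain ⟨b, hb⟩ := hq
    exact ⟨a + b, fun t => by simp [ha, hb]⟩
  | mul_X p φ hp =>
    obtain ⟨a, ha⟩ := hp
    exact ⟨a * (Polynomial.C (φ x) + Polynomial.C (φ v) * Polynomial.X), fun t => by
      simp [ha, mul_comm t]⟩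

/-- The product of two nonzero polynomial functions is not zero. -/
lemma exists_ne_zero [Infinite k] (hf : IsPolyFun f) (hg : IsPolyFun g)
    (hf0 : ∃ x, f x ≠ 0) (hg0 : ∃ x, g x ≠ 0) : ∃ x, f x ≠ 0 ∧ g x ≠ 0 := by
  obtain ⟨x, hx⟩ := hf0
  obtain ⟨y, hy⟩ := hg0
  -- Restrict to the line through `x` and `y`: both functions become nonzero polynomials in one
  -- variable, by their values at `0` and at `1`.
  obtain ⟨p, hp⟩ := hf.exists_polynomial x (y - x)
  obtain ⟨q, hq⟩ := hg.exists_polynomial x (y - x)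
  have hp0 : p ≠ 0 := by
    rintro rfl
    exact hx (by simpa using (hp 0).symm)
  have hq0 : q ≠ 0 := by
    rintro rfl
    exact hy (by simpa using (hq 1).symm)
  obtain ⟨t, ht⟩ : ∃ t, (p * q).eval t ≠ 0 := by
    by_contra! h
    exact mul_ne_zero hp0 hq0 (Polynomial.funext fun t => by simpa using h t)
  rw [Polynomial.eval_mul, hp, hq] at ht
  exact ⟨_, left_ne_zero_of_mul ht, right_ne_zero_of_mul ht⟩

/-- A polynomial function of a map whose coordinates are quotients of polynomial functions by `b`
becomes a polynomial function after multiplication by a power of `b`. -/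
lemma exists_pow_mul {f : F → k} (hf : IsPolyFun f) {u : E → F} {b : E → k} (hb : IsPolyFun b)
    (hu : ∀ φ : Module.Dual k F, ∃ g, IsPolyFun g ∧ ∀ x, b x ≠ 0 → g x = b x * φ (u x)) :
    ∃ (N : ℕ) (g : E → k), IsPolyFun g ∧ ∀ x, b x ≠ 0 → g x = b x ^ N * f (u x) := by
  obtain ⟨P, hP⟩ := hf
  simp only [← hP, polyFun]
  clear hP
  induction P using MvPolynomial.induction_on with
  | C a => exact ⟨0, _, const a, fun x _ => by simp⟩
  | add p q hp hq =>
    obtain ⟨M, g, hg, hM⟩ := hp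
    obtain ⟨N, h, hh, hN⟩ := hq
    refine ⟨M + N, _, ((hb.pow N).mul hg).add ((hb.pow M).mul hh), fun x hx => ?_⟩
    rw [map_add, hM x hx, hN x hx]
    ring
  | mul_X p φ hp =>
    obtain ⟨M, g, hg, hM⟩ := hp
    obtain ⟨h, hh, hφ⟩ := hu φ
    refine ⟨M + 1, _, hg.mul hh, fun x hx => ?_⟩
    rw [map_mul, eval_X, hM x hx, hφ x hx]
    ring

end IsPolyFun

lemma IsPolyMap.of_linear (L : E →ₗ[k] F) : IsPolyMap (k := k) fun x => L x :=
  fun φ => IsPolyFun.linear (φ ∘ₗ L)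

lemma IsPolyMap.prodMk {G : Type*} [AddCommGroup G] [Module k G] {u : E → F} {v : E → G}
    (hu : IsPolyMap (k := k) u) (hv : IsPolyMap (k := k) v) :
    IsPolyMap (k := k) fun x => (u x, v x) := by
  intro φ
  convert (hu (φ ∘ₗ LinearMap.inl k F G)).add (hv (φ ∘ₗ LinearMap.inr k F G)) using 2
  simp [← map_add]

lemma IsPolyMap.smul {u : E → F} {f : E → k} (hf : IsPolyFun f) (hu : IsPolyMap (k := k) u) :
    IsPolyMap (k := k) fun x => f x • u x := by
  intro φ
  simpa using hf.mul (hu φ)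

lemma IsPolyMap.add {u v : E → F} (hu : IsPolyMap (k := k) u) (hv : IsPolyMap (k := k) v) :
    IsPolyMap (k := k) fun x => u x + v x := by
  intro φ
  simpa using (hu φ).add (hv φ)

lemma isClosed_aff_iff {Z : Set (Aff k E)} :
    IsClosed Z ↔ ∃ S : Set (MvPolynomial (Module.Dual k E) k),
      Z = {x : E | ∀ P ∈ S, polyFun k E P x = 0} := by
  rw [← isOpen_compl_iff]
  change Zᶜᶜ ∈ _ ↔ _
  rw [compl_compl]
  rfl

lemma isClosed_of_forall_isPolyFun {ι : Type*} {f : ι → E → k} (hf : ∀ i, IsPolyFun (f i)) :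
    IsClosed (X := Aff k E) {x : E | ∀ i, f i x = 0} := by
  choose P hP using hf
  refine isClosed_aff_iff.2 ⟨Set.range P, ?_⟩
  ext x
  change (∀ i, f i x = 0) ↔ ∀ Q ∈ Set.range P, polyFun k E Q x = 0
  simp only [Set.forall_mem_range]
  exact forall_congr' fun i => (iff_of_eq (congrArg (· = 0) (hP i x))).symm

lemma IsPolyFun.isClosed {f : E → k} (hf : IsPolyFun f) :
    IsClosed (X := Aff k E) {x : E | f x = 0} := by
  simpa using isClosed_of_forall_isPolyFun (ι := Unit) fun _ => hf

lemma IsPolyFun.isOpen {f : E → k} (hf : IsPolyFun f) :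
    IsOpen (X := Aff k E) {x : E | f x ≠ 0} :=
  hf.isClosed.isOpen_compl

/-- A point outside of a closed set is separated from it by a polynomial function. -/
lemma exists_isPolyFun_of_notMem {Z : Set (Aff k E)} (hZ : IsClosed Z) {x : E} (hx : x ∉ Z) :
    ∃ f : E → k, IsPolyFun f ∧ (∀ y ∈ Z, f y = 0) ∧ f x ≠ 0 := by
  obtain ⟨S, rfl⟩ := isClosed_aff_iff.1 hZ
  have hx' : ¬ ∀ P ∈ S, polyFun k E P x = 0 := hx
  push Not at hx'
  obtain ⟨P, hP, h⟩ := hx'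
  exact ⟨_, IsPolyFun.of_polyFun P, fun y hy => hy P hP, h⟩

lemma mem_of_forall_isPolyFun {Z : Set (Aff k E)} (hZ : IsClosed Z) {x : E}
    (h : ∀ f : E → k, IsPolyFun f → (∀ y ∈ Z, f y = 0) → f x = 0) : x ∈ Z := by
  by_contra hx
  obtain ⟨f, hf, hfZ, hfx⟩ := exists_isPolyFun_of_notMem hZ hx
  exact hfx (h f hf hfZ)

lemma IsPolyMap.continuous {u : E → F} (hu : IsPolyMap (k := k) u) :
    Continuous (X := Aff k E) (Y := Aff k F) u := by
  refine continuous_iff_isClosed.2 fun Z hZ => ?_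
  obtain ⟨S, rfl⟩ := isClosed_aff_iff.1 hZ
  have := isClosed_of_forall_isPolyFun (k := k) (ι := S) (f := fun P x => polyFun k F P (u x))
    fun P => (IsPolyFun.of_polyFun (P : MvPolynomial (Module.Dual k F) k)).comp hu
  convert this using 1
  ext x
  exact ⟨fun h P => h P P.2, fun h P hP => h ⟨P, hP⟩⟩

/-- Clearing denominators turns the equations of `Z` into polynomial equations for a map whose
coordinates are fractions with denominator `b`. -/
lemma isClosed_preimage_quotient {u : E → F} {b : E → k} (hb : IsPolyFun b)
    (hu : ∀ φ : Module.Dual k F, ∃ g, IsPolyFun g ∧ ∀ x, b x ≠ 0 → g x = b x * φ (u x))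
    {Z : Set (Aff k F)} (hZ : IsClosed Z) :
    IsClosed (X := Aff k E) {x : E | b x ≠ 0 → u x ∈ Z} := by
  choose N g hg hN using fun f : {f : F → k // IsPolyFun f ∧ ∀ y : F, y ∈ Z → f y = 0} =>
    f.2.1.exists_pow_mul hb hu
  -- The additional factor `b` makes the equations trivial where `b` vanishes.
  convert isClosed_of_forall_isPolyFun fun f => hb.mul (hg f) using 1
  refine Set.ext fun (x : E) => ⟨fun h f => ?_, fun h hx => mem_of_forall_isPolyFun hZ ?_⟩
  · by_cases hx : b x = 0
    · rw [hx, zero_mul]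
    · rw [hN f x hx, f.2.2 _ (h hx), mul_zero, mul_zero]
  · intro f hf hfZ
    have := h ⟨f, hf, hfZ⟩
    rw [hN _ x hx] at this
    exact (mul_eq_zero.1 ((mul_eq_zero.1 this).resolve_left hx)).resolve_left (pow_ne_zero _ hx)

instance [Infinite k] : IrreducibleSpace (Aff k E) where
  toNonempty := ⟨(0 : E)⟩
  isPreirreducible_univ := by
    rintro U V hU hV ⟨x, -, hx⟩ ⟨y, -, hy⟩
    obtain ⟨f, hf, hfU, hfx⟩ := exists_isPolyFun_of_notMem hU.isClosed_compl
      (x := x) (fun h => h hx)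
    obtain ⟨g, hg, hgV, hgy⟩ := exists_isPolyFun_of_notMem hV.isClosed_compl
      (x := y) (fun h => h hy)
    obtain ⟨z, hfz, hgz⟩ := hf.exists_ne_zero hg ⟨x, hfx⟩ ⟨y, hgy⟩
    exact ⟨z, trivial, by_contra fun h => hfz (hfU z h), by_contra fun h => hgz (hgV z h)⟩

end PolynomialFunctions

/-! ### Elimination theory -/

section Elimination

variable {k : Type*} [Field k] {E V : Type*} [AddCommGroup E] [Module k E]
  [AddCommGroup V] [Module k V]

/-- The ring of polynomials whose variables are the linear forms on `E`. -/
abbrev DualPoly (k E : Type*) [Field k] [AddCommGroup E] [Module k E] : Type _ :=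
  MvPolynomial (Module.Dual k E) k

/-- Evaluation of the elements of `DualPoly k E` at a point of `E`. -/
noncomputable def spec (k : Type*) {E : Type*} [Field k] [AddCommGroup E] [Module k E] (x : E) :
    DualPoly k E →+* k :=
  eval fun φ : Module.Dual k E => φ x

lemma isPolyFun_spec (P : DualPoly k E) : IsPolyFun fun x => spec k x P := ⟨P, fun _ => rfl⟩

lemma spec_surjective (x : E) : Function.Surjective (spec k x) :=
  fun c => ⟨C c, by simp [spec]⟩

lemma eval_smul_of_isHomogeneous {σ : Type*} {R : Type*} [CommRing R] {p : MvPolynomial σ R}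
    {d : ℕ} (hp : p.IsHomogeneous d) (c : R) (v : σ → R) :
    eval (c • v) p = c ^ d * eval v p := by
  rw [eval_eq, eval_eq, Finset.mul_sum]
  refine Finset.sum_congr rfl fun ν hν => ?_
  have h : ∑ i ∈ ν.support, ν i = d := by
    rw [← hp.degree_eq_sum_deg_support hν]
  simp only [Pi.smul_apply, smul_eq_mul, mul_pow, Finset.prod_mul_distrib, Finset.prod_pow_eq_pow_sum, h]
  ring

lemma homogeneousComponent_map {σ R S : Type*} [CommRing R] [CommRing S] (f : R →+* S)
    (p : MvPolynomial σ R) (d : ℕ) :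
    homogeneousComponent d (map f p) = map f (homogeneousComponent d p) := by
  ext ν
  simp only [coeff_homogeneousComponent, coeff_map]
  split_ifs <;> simp

/-- If a polynomial vanishes at all the nonzero multiples of a vector, then so do its homogeneous
components. -/
lemma eval_homogeneousComponent_eq_zero [Infinite k] {σ : Type*} {p : MvPolynomial σ k}
    {v : σ → k} (h : ∀ c : k, c ≠ 0 → eval (c • v) p = 0) (d : ℕ) :
    eval v (homogeneousComponent d p) = 0 := by
  -- As a polynomial in `c`, the value at `c • v` has the values of the homogeneous components as
  -- coefficients, and it has infinitely many roots.
  have key : ∑ i ∈ Finset.range (p.totalDegree + 1),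
      Polynomial.monomial i (eval v (homogeneousComponent i p)) = 0 := by
    refine Polynomial.eq_zero_of_infinite_isRoot _
      ((Set.finite_singleton (0 : k)).infinite_compl.mono fun c hc => ?_)
    have := h c hc
    rw [← sum_homogeneousComponent p, map_sum] at this
    simp only [eval_smul_of_isHomogeneous (homogeneousComponent_isHomogeneous _ _)] at this
    simpa [Polynomial.IsRoot, Polynomial.eval_finsetSum, mul_comm] using this
  by_cases hd : d < p.totalDegree + 1
  · have := congrArg (Polynomial.coeff · d) key
    simpa [Polynomial.finsetSum_coeff, Polynomial.coeff_monomial, hd] using this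
  · rw [homogeneousComponent_eq_zero _ _ (by omega), map_zero]

lemma exists_generic_polynomial {σ : Type*} [Fintype σ] {f : E × (σ → k) → k}
    (hf : IsPolyFun f) :
    ∃ G : MvPolynomial σ (DualPoly k E), ∀ x v, eval v (map (spec k x) G) = f (x, v) := by
  classical
  obtain ⟨P, hP⟩ := hf
  simp only [← hP, polyFun]
  clear hP
  induction P using MvPolynomial.induction_on with
  | C a => exact ⟨C (C a), fun x v => by simp [spec]⟩
  | add p q hp hq =>
    obtain ⟨G, hG⟩ := hp
    obtain ⟨H, hH⟩ := hq
    exact ⟨G + H, fun x v => by simp [hG, hH]⟩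
  | mul_X p φ hp =>
    obtain ⟨G, hG⟩ := hp
    refine ⟨G * (C (X (φ ∘ₗ LinearMap.inl k E (σ → k))) +
      ∑ i, C (C (φ (0, Pi.single i 1))) * X i), fun x v => ?_⟩
    have hv : φ (x, v) = φ (x, 0) + ∑ i, φ (0, Pi.single i 1) * v i := by
      have h1 : (x, v) = (x, 0) + LinearMap.inr k E (σ → k) v := by simp
      rw [h1, map_add]
      congr 1
      conv_lhs => rw [pi_eq_sum_univ' v, map_sum, map_sum]
      refine Finset.sum_congr rfl fun i _ => ?_
      rw [map_smul, map_smul, smul_eq_mul, mul_comm]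
      congr 2
    rw [map_mul, map_mul, hG]
    simp [hv, spec]

/-- The ideal of the polynomials with coefficients in `DualPoly k E` which vanish on a set. -/
noncomputable def genericIdeal {σ : Type*} (Z : Set (E × (σ → k))) :
    Ideal (MvPolynomial σ (DualPoly k E)) :=
  ⨅ p : Z, RingHom.ker ((eval p.1.2).comp (map (spec k p.1.1)))

lemma mem_genericIdeal {σ : Type*} {Z : Set (E × (σ → k))} {G : MvPolynomial σ (DualPoly k E)} :
    G ∈ genericIdeal Z ↔ ∀ x v, (x, v) ∈ Z → eval v (map (spec k x) G) = 0 := by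
  rw [genericIdeal, Submodule.mem_iInf, Subtype.forall, Prod.forall]
  rfl

lemma homogeneousComponent_mem_genericIdeal [Infinite k] {σ : Type*} {Z : Set (E × (σ → k))}
    (hZ : ∀ x v, (x, v) ∈ Z → ∀ c : k, c ≠ 0 → (x, c • v) ∈ Z)
    {G : MvPolynomial σ (DualPoly k E)} (hG : G ∈ genericIdeal Z) (d : ℕ) :
    homogeneousComponent d G ∈ genericIdeal Z := by
  rw [mem_genericIdeal] at hG ⊢
  intro x v hp
  rw [← homogeneousComponent_map]
  exact eval_homogeneousComponent_eq_zero (fun c hc => hG x _ (hZ x v hp c hc)) d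

/-- Specialized at `x`, the equations of `Z` have no common zero except possibly the origin. By the
Nullstellensatz the radical of the specialized ideal contains the irrelevant ideal, hence the ideal
itself contains a power of it. -/
lemma exists_monomials_mem [IsAlgClosed k] {σ : Type*} [Fintype σ] {Z : Set (Aff k (E × (σ → k)))}
    (hZc : IsClosed Z) {x : E} (hx : ∀ v : σ → k, v ≠ 0 → (x, v) ∉ Z) :
    ∃ N : ℕ, ∀ ν : σ →₀ ℕ, ν.degree = N →
      ∃ G ∈ genericIdeal (E := E) (σ := σ) Z, map (spec k x) G = monomial ν 1 := by
  have hsurj : Function.Surjective (map (σ := σ) (spec k x)) := map_surjective _ (spec_surjective x)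
  set J : Ideal (MvPolynomial σ k) := (genericIdeal (E := E) (σ := σ) Z).map (map (spec k x))
  have hJ : idealOfVars σ k ≤ J.radical := by
    rw [← vanishingIdeal_zeroLocus_eq_radical (K := k) J, idealOfVars, Ideal.span_le]
    rintro _ ⟨i, rfl⟩ v hv
    suffices v = 0 by simp [this]
    by_contra hv0
    obtain ⟨f, hf, hfZ, hfx⟩ := exists_isPolyFun_of_notMem hZc (hx v hv0)
    obtain ⟨G, hG⟩ := exists_generic_polynomial hf
    refine hfx ?_
    rw [← hG, ← coe_aeval_eq_eval]
    refine hv _ (Ideal.mem_map_of_mem _ ?_)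
    refine mem_genericIdeal.2 fun y w hp => ?_
    rw [hG]
    exact hfZ _ hp
  obtain ⟨N, hN⟩ := Ideal.exists_pow_le_of_le_radical_of_fg hJ (idealOfVars_fg σ k)
  refine ⟨N, fun ν hν => (Ideal.mem_map_iff_of_surjective _ hsurj).1 (hN ?_)⟩
  rw [mem_pow_idealOfVars_iff']
  intro μ hμ
  classical
  rw [coeff_monomial, if_neg]
  rintro rfl
  omega

lemma eval_eq_sum_finsuppAntidiag {σ R : Type*} [CommRing R] [Fintype σ] [DecidableEq σ]
    {p : MvPolynomial σ R} {d : ℕ} (hp : p.IsHomogeneous d) (v : σ → R) :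
    eval v p = ∑ ν ∈ (Finset.univ : Finset σ).finsuppAntidiag d, coeff ν p * ∏ i, v i ^ ν i := by
  rw [eval_eq']
  refine Finset.sum_subset (fun ν hν => ?_) fun ν _ hν => ?_
  · have := hp.degree_eq_sum_deg_support hν
    rw [Finset.mem_finsuppAntidiag, this]
    exact ⟨(Finset.sum_subset (Finset.subset_univ _) fun i _ hi => by simpa using hi).symm,
      Finset.subset_univ _⟩
  · rw [notMem_support_iff.1 hν, zero_mul]

lemma isClosed_elimination_pi [IsAlgClosed k] {σ : Type*} [Fintype σ]
    {Z : Set (Aff k (E × (σ → k)))} (hZc : IsClosed Z)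
    (hZ : ∀ (x : E) (v : σ → k), (x, v) ∈ Z → ∀ c : k, c ≠ 0 → (x, c • v) ∈ Z) :
    IsClosed (X := Aff k E) {x : E | ∃ v : σ → k, v ≠ 0 ∧ (x, v) ∈ Z} := by
  classical
  have : Infinite k := IsAlgClosed.instInfinite
  rw [← isOpen_compl_iff, isOpen_iff_forall_mem_open]
  intro (x : E) hx
  have hx' : ∀ v : σ → k, v ≠ 0 → (x, v) ∉ Z := fun v hv h => hx ⟨v, hv, h⟩
  obtain ⟨N, hN⟩ := exists_monomials_mem hZc hx'
  let S : Type _ := (Finset.univ : Finset σ).finsuppAntidiag N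
  have hS : ∀ ν : σ →₀ ℕ, ν.degree = N ↔ ν ∈ (Finset.univ : Finset σ).finsuppAntidiag N := by
    intro ν
    simp [Finset.mem_finsuppAntidiag, Finsupp.degree_eq_sum]
  choose! G hG hGν using hN
  -- As `Z` is conic, components of degree `N` still vanish on it; they are linear combinations of
  -- the monomials of degree `N` only, so their coefficients form a square matrix.
  let r : S → MvPolynomial σ (DualPoly k E) := fun ν => homogeneousComponent N (G ν)
  have hr : ∀ ν : S, map (spec k x) (r ν) = monomial ν.1 1 := fun ν => by
    rw [← homogeneousComponent_map, hGν _ ((hS _).2 ν.2)]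
    exact homogeneousComponent_eq_self (isHomogeneous_monomial _ ((hS _).2 ν.2))
  have hrZ : ∀ ν : S, r ν ∈ genericIdeal (E := E) (σ := σ) Z := fun ν =>
    homogeneousComponent_mem_genericIdeal hZ (hG _ ((hS _).2 ν.2)) N
  let M : Matrix S S (DualPoly k E) := Matrix.of fun μ ν => coeff ν.1 (r μ)
  -- The matrix is the identity at `x`. Where it is invertible, a vector of the fibre of `Z` has all
  -- its monomials of degree `N` equal to zero, in particular the powers of its coordinates.
  refine ⟨{y : E | spec k y M.det ≠ 0}, ?_, (isPolyFun_spec _).isOpen, ?_⟩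
  · rintro (y : E) (hy : spec k y M.det ≠ 0) ⟨v, hv0, hv⟩
    rw [RingHom.map_det] at hy
    refine hv0 ?_
    have h0 : ((spec k y).mapMatrix M).mulVec (fun ν : S => ∏ i, v i ^ ν.1 i) = 0 := by
      ext μ
      have h1 := mem_genericIdeal.1 (hrZ μ) y v hv
      have hh : (map (spec k y) (r μ)).IsHomogeneous N :=
        (homogeneousComponent_isHomogeneous N (G μ)).map _
      rw [eval_eq_sum_finsuppAntidiag hh, ← Finset.sum_coe_sort] at h1
      rw [Pi.zero_apply, ← h1, Matrix.mulVec, dotProduct]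
      refine Finset.sum_congr rfl fun ν _ => ?_
      rw [coeff_map]
      rfl
    have h2 := Matrix.eq_zero_of_mulVec_eq_zero hy h0
    ext i
    have h3 := congrFun h2 ⟨Finsupp.single i N, (hS _).1 (by simp)⟩
    have h4 : ∏ j, v j ^ (Finsupp.single i N) j = v i ^ N := by
      rw [Finset.prod_eq_single i]
      · simp
      · intro j _ hj
        simp [hj.symm]
      · simp
    exact eq_zero_of_pow_eq_zero (h4.symm.trans h3)
  · change spec k x M.det ≠ 0
    rw [RingHom.map_det]
    have : (spec k x).mapMatrix M = 1 := by
      ext μ ν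
      have := congrArg (coeff ν.1) (hr μ)
      rw [coeff_map, coeff_monomial] at this
      rw [RingHom.mapMatrix_apply, Matrix.map_apply, Matrix.one_apply]
      refine this.trans (if_congr ?_ rfl rfl)
      rw [Subtype.ext_iff]
    rw [this, Matrix.det_one]
    exact one_ne_zero

/-- The main theorem of elimination theory: the projection to `E` of a closed subset of
`E × ℙ(V)` is closed. -/
lemma isClosed_elimination [IsAlgClosed k] [Module.Finite k V]
    {Z : Set (Aff k (E × V))} (hZc : IsClosed Z)
    (hZ : ∀ (x : E) (v : V), (x, v) ∈ Z → ∀ c : k, c ≠ 0 → (x, c • v) ∈ Z) :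
    IsClosed (X := Aff k E) {x : E | ∃ v : V, v ≠ 0 ∧ (x, v) ∈ Z} := by
  let e := (Module.finBasis k V).equivFun
  have hc : Continuous (X := Aff k (E × (Fin (Module.finrank k V) → k))) (Y := Aff k (E × V))
      (fun p => (p.1, e.symm p.2)) :=
    (IsPolyMap.of_linear (k := k)
      (LinearMap.prodMap (LinearMap.id (M := E)) e.symm.toLinearMap)).continuous
  have := isClosed_elimination_pi (hZc.preimage hc) fun x v h c hc0 => by
    have := hZ _ _ h c hc0
    rw [← map_smul] at this
    exact this
  convert this using 1
  refine Set.ext fun (x : E) => ⟨?_, ?_⟩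
  · rintro ⟨v, hv, h⟩
    refine ⟨e v, by simpa using hv, ?_⟩
    change (x, e.symm (e v)) ∈ Z
    rwa [e.symm_apply_apply]
  · rintro ⟨v, hv, h⟩
    exact ⟨e.symm v, by simpa using hv, h⟩

end Elimination

/-! ### Irreducible hypersurfaces -/

section Hypersurfaces

variable {k : Type*} [Field k] {E : Type*} [AddCommGroup E] [Module k E]

lemma IsPolyFun.exists_mvPolynomial {ι : Type*} [Fintype ι] (e : E ≃ₗ[k] (ι → k)) {f : E → k}
    (hf : IsPolyFun f) : ∃ p : MvPolynomial ι k, ∀ x, eval (e x) p = f x := by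
  obtain ⟨G, hG⟩ := exists_generic_polynomial (E := PUnit) (σ := ι)
    (hf.comp (IsPolyMap.of_linear (e.symm.toLinearMap ∘ₗ LinearMap.snd k PUnit (ι → k))))
  exact ⟨map (spec k 0) G, fun x => by simpa using hG 0 (e x)⟩

lemma isPolyFun_eval {ι : Type*} [Fintype ι] (e : E ≃ₗ[k] (ι → k)) (p : MvPolynomial ι k) :
    IsPolyFun fun x => eval (e x) p := by
  induction p using MvPolynomial.induction_on with
  | C a => simpa using IsPolyFun.const a
  | add p q hp hq => simpa using hp.add hq
  | mul_X p i hp =>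
    simpa using hp.mul (IsPolyFun.linear (LinearMap.proj i ∘ₗ e.toLinearMap))

lemma eq_zero_or_eq_zero_of_isIrreducible {H : Set (Aff k E)} (hH : IsIrreducible H)
    {f g : E → k} (hf : IsPolyFun f) (hg : IsPolyFun g) (h : ∀ x : E, x ∈ H → f x * g x = 0) :
    (∀ x : E, x ∈ H → f x = 0) ∨ ∀ x : E, x ∈ H → g x = 0 := by
  by_contra! hc
  obtain ⟨⟨x, hxH, hx⟩, y, hyH, hy⟩ := hc
  obtain ⟨z, hzH, hzf, hzg⟩ := hH.2 _ _ hf.isOpen hg.isOpen ⟨x, hxH, hx⟩ ⟨y, hyH, hy⟩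
  exact mul_ne_zero hzf hzg (h z hzH)

/-- The Nullstellensatz for the prime ideal generated by `h`. -/
lemma dvd_of_forall_eval_eq_zero [IsAlgClosed k] {ι : Type*} [Finite ι] {h g : MvPolynomial ι k}
    (hh : Prime h) (hg : ∀ x : ι → k, eval x h = 0 → eval x g = 0) : h ∣ g := by
  have : (Ideal.span {h}).IsPrime := (Ideal.span_singleton_prime hh.ne_zero).2 hh
  rw [← Ideal.mem_span_singleton, ← IsPrime.vanishingIdeal_zeroLocus (K := k) (Ideal.span {h})]
  intro x hx
  have := hx h (Ideal.mem_span_singleton_self h)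
  rw [aeval_eq_eval] at this ⊢
  exact hg x this

/-- Near a general point of an irreducible hypersurface `H`, every hypersurface is either empty or
contained in `H`. -/
lemma exists_isPolyFun_hypersurface [IsAlgClosed k] [Module.Finite k E] {H : Set (Aff k E)}
    (hH : IsIrreducible H) {s R : E → k} (hs : IsPolyFun s) (hR : IsPolyFun R)
    (hsR : ∀ x : E, s x ≠ 0 → (x ∈ H ↔ R x = 0)) (hsH : ∃ x : E, x ∈ H ∧ s x ≠ 0)
    {P : E → k} (hP : IsPolyFun P) (hP0 : ∃ x, P x ≠ 0) :
    ∃ Q : E → k, IsPolyFun Q ∧ (∃ x : E, x ∈ H ∧ Q x ≠ 0) ∧ (∀ x, Q x ≠ 0 → s x ≠ 0) ∧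
      ∀ x : E, P x = 0 → Q x ≠ 0 → x ∈ H := by
  let e := (Module.finBasis k E).equivFun
  have hRH : ∀ x : E, x ∈ H → R x = 0 := by
    refine (eq_zero_or_eq_zero_of_isIrreducible hH hs hR fun x hx => ?_).resolve_left ?_
    · by_cases hsx : s x = 0
      · rw [hsx, zero_mul]
      · rw [(hsR x hsx).1 hx, mul_zero]
    · obtain ⟨x, hx, hsx⟩ := hsH
      exact fun h => hsx (h x hx)
  obtain ⟨p, hp⟩ := hP.exists_mvPolynomial e
  obtain ⟨r, hr⟩ := hR.exists_mvPolynomial e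
  obtain ⟨σ, hσ⟩ := hs.exists_mvPolynomial e
  have hp0 : p ≠ 0 := by
    rintro rfl
    obtain ⟨x, hx⟩ := hP0
    exact hx (by rw [← hp, map_zero])
  by_cases hr0 : r = 0
  · refine ⟨s, hs, hsH, fun _ h => h, fun x _ hsx => (hsR x hsx).2 ?_⟩
    rw [← hr, hr0, map_zero]
  -- A nonzero polynomial vanishing on the irreducible set `H` has a prime factor vanishing on `H`.
  have hfac : ∀ q : MvPolynomial (Fin (Module.finrank k E)) k, q ≠ 0 →
      (∀ x : E, x ∈ H → eval (e x) q = 0) → ∃ h, Prime h ∧ h ∣ q ∧ ∀ x : E, x ∈ H → eval (e x) h = 0 := by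
    intro q
    induction q using UniqueFactorizationMonoid.induction_on_prime with
    | h₁ => exact fun h => absurd rfl h
    | h₂ u hu =>
      intro _ h
      obtain ⟨x, hx, -⟩ := hsH
      exact absurd (h x hx) (hu.map (eval (e x))).ne_zero
    | h₃ a h ha hh ih =>
      intro _ hv
      rcases eq_zero_or_eq_zero_of_isIrreducible hH (isPolyFun_eval e h) (isPolyFun_eval e a)
        (fun x hx => by rw [← map_mul]; exact hv x hx) with h1 | h1
      · exact ⟨h, hh, dvd_mul_right _ _, h1⟩
      · obtain ⟨g, hg, hga, hgH⟩ := ih ha h1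
        exact ⟨g, hg, hga.mul_left _, hgH⟩
  obtain ⟨h, hh, hhr, hhH⟩ := hfac r hr0 fun x hx => by rw [hr]; exact hRH x hx
  have hhs : ∀ x : E, eval (e x) h = 0 → s x ≠ 0 → x ∈ H := fun x hx hsx => by
    rw [hsR x hsx, ← hr]
    obtain ⟨c, rfl⟩ := hhr
    rw [map_mul, hx, zero_mul]
  -- Remove from `p` all the factors `h`, which cut out `H` where `s ≠ 0`. What is left does not
  -- vanish identically on `H`, and away from its zeros `P = 0` forces `h = 0`.
  obtain ⟨p', hpp, hp'⟩ :=
    (FiniteMultiplicity.of_prime_left hh hp0).exists_eq_pow_mul_and_not_dvd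
  refine ⟨fun x => s x * eval (e x) p', hs.mul (isPolyFun_eval e p'), ?_,
    fun x hx => left_ne_zero_of_mul hx, fun x hx hQ => ?_⟩
  · by_contra! hc
    -- If `s p'` vanished on `H`, this product would vanish on all of `h = 0`, whose points with `s
    -- ≠ 0` belong to `H`; but `h` divides neither `σ` nor `p'`.
    have hdvd : h ∣ σ * (σ * p') := by
      refine dvd_of_forall_eval_eq_zero hh fun y hy => ?_
      obtain ⟨x, rfl⟩ := e.surjective y
      by_cases hsx : s x = 0
      · rw [map_mul, hσ, hsx, zero_mul]
      · rw [map_mul, map_mul, hσ, hc x (hhs x hy hsx), mul_zero]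
    have hhσ : ¬ h ∣ σ := by
      rintro ⟨c, rfl⟩
      obtain ⟨x, hx, hsx⟩ := hsH
      exact hsx (by rw [← hσ, map_mul, hhH x hx, zero_mul])
    rcases hh.dvd_or_dvd hdvd with h1 | h1
    · exact hhσ h1
    · exact (hh.dvd_or_dvd h1).elim hhσ hp'
  · refine hhs x ?_ (left_ne_zero_of_mul hQ)
    rw [← hp, hpp, map_mul, map_pow] at hx
    exact eq_zero_of_pow_eq_zero ((mul_eq_zero.1 hx).resolve_right (right_ne_zero_of_mul hQ))

end Hypersurfaces

/-! ### Polynomial families of polynomials -/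

section Families

variable {k : Type*} [Field k] {E : Type*} [AddCommGroup E] [Module k E] {σ : Type*}

/-- A family of polynomials whose coefficients are polynomial functions on `E`, obtained by
specialization of a polynomial over `DualPoly k E`. -/
def IsPolyFam (G : E → MvPolynomial σ k) : Prop :=
  ∃ G' : MvPolynomial σ (DualPoly k E), ∀ x, map (spec k x) G' = G x

namespace IsPolyFam

variable {G H : E → MvPolynomial σ k}

lemma const (p : MvPolynomial σ k) : IsPolyFam fun _ : E => p :=
  ⟨map C p, fun x => by
    rw [map_map, show (spec k x).comp C = RingHom.id k from RingHom.ext fun c => by simp [spec],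
      map_id]⟩

lemma of_isPolyFun {f : E → k} (hf : IsPolyFun f) :
    IsPolyFam fun x => (C (f x) : MvPolynomial σ k) := by
  obtain ⟨P, hP⟩ := hf
  exact ⟨C P, fun x => by rw [map_C]; exact congrArg C (hP x)⟩

lemma add (hG : IsPolyFam G) (hH : IsPolyFam H) : IsPolyFam fun x => G x + H x := by
  obtain ⟨G', hG⟩ := hG
  obtain ⟨H', hH⟩ := hH
  exact ⟨G' + H', fun x => by rw [map_add, hG, hH]⟩

lemma sub (hG : IsPolyFam G) (hH : IsPolyFam H) : IsPolyFam fun x => G x - H x := by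
  obtain ⟨G', hG⟩ := hG
  obtain ⟨H', hH⟩ := hH
  exact ⟨G' - H', fun x => by rw [map_sub, hG, hH]⟩

lemma mul (hG : IsPolyFam G) (hH : IsPolyFam H) : IsPolyFam fun x => G x * H x := by
  obtain ⟨G', hG⟩ := hG
  obtain ⟨H', hH⟩ := hH
  exact ⟨G' * H', fun x => by rw [map_mul, hG, hH]⟩

lemma pderiv (hG : IsPolyFam G) (i : σ) : IsPolyFam fun x => MvPolynomial.pderiv i (G x) := by
  obtain ⟨G', hG⟩ := hG
  exact ⟨MvPolynomial.pderiv i G', fun x => by rw [← pderiv_map, hG]⟩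

lemma coeff (hG : IsPolyFam G) (ν : σ →₀ ℕ) : IsPolyFun fun x => (G x).coeff ν := by
  obtain ⟨G', hG⟩ := hG
  refine ⟨G'.coeff ν, fun x => ?_⟩
  beta_reduce
  rw [← hG, coeff_map]
  rfl

lemma eval (hG : IsPolyFam G) {u : E → σ → k} (hu : ∀ i, IsPolyFun fun x => u x i) :
    IsPolyFun fun x => MvPolynomial.eval (u x) (G x) := by
  obtain ⟨G', hG⟩ := hG
  choose U hU using hu
  refine ⟨MvPolynomial.eval U G', fun x => ?_⟩
  change spec k x (MvPolynomial.eval U G') = _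
  beta_reduce
  rw [← hG, eval_map, MvPolynomial.eval, coe_eval₂Hom, eval₂_comp_left, RingHom.comp_id]
  exact congrArg (eval₂ (spec k x) · G') (funext fun i => hU i x)

lemma isClosed (hG : IsPolyFam G) : IsClosed (X := Aff k E) {x : E | G x = 0} := by
  convert isClosed_of_forall_isPolyFun hG.coeff using 1
  exact Set.ext fun x => ⟨fun h ν => by simp [show G x = 0 from h], fun h => ext _ _ fun ν => h ν⟩

lemma of_linear {d : ℕ} (L : E →ₗ[k] Form k d) :
    IsPolyFam fun x => (L x : MvPolynomial (Fin 3) k) := by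
  classical
  refine ⟨∑ ν ∈ (Finset.univ : Finset (Fin 3)).finsuppAntidiag d,
    monomial ν (X (lcoeff k ν ∘ₗ (Form k d).subtype ∘ₗ L)), fun x => ?_⟩
  ext μ
  simp only [map_sum, map_monomial, coeff_sum, coeff_monomial]
  rw [Finset.sum_ite_eq']
  split_ifs with h
  · simp [spec]
  · refine ((mem_homogeneousSubmodule _ _).1 (L x).2).coeff_eq_zero ?_ |>.symm
    rintro rfl
    simp [Finset.mem_finsuppAntidiag, Finsupp.degree_eq_sum] at h

/-- A polynomial family of forms is a polynomial map. -/
lemma isPolyMap {d : ℕ} {u : E → Form k d}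
    (hu : IsPolyFam fun x => (u x : MvPolynomial (Fin 3) k)) : IsPolyMap (k := k) u := by
  classical
  intro φ
  let S := (Finset.univ : Finset (Fin 3)).finsuppAntidiag d
  have hS : ∀ ν ∈ S, monomial ν (1 : k) ∈ Form k d := fun ν hν =>
    (mem_homogeneousSubmodule _ _).2 (isHomogeneous_monomial _ (by
      rw [Finsupp.degree_eq_sum]
      exact (Finset.mem_finsuppAntidiag.1 hν).1))
  have key : ∀ x, u x = ∑ ν : S, (u x : MvPolynomial (Fin 3) k).coeff ν.1 •
      (⟨monomial ν.1 1, hS _ ν.2⟩ : Form k d) := by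
    intro x
    ext μ
    rw [AddSubmonoidClass.coe_finsetSum, coeff_sum]
    refine Eq.trans ?_ (Finset.sum_coe_sort S fun ν => MvPolynomial.coeff μ
        ((u x : MvPolynomial (Fin 3) k).coeff ν • monomial ν (1 : k))).symm
    simp only [smul_monomial, coeff_monomial, smul_eq_mul, mul_one]
    rw [Finset.sum_ite_eq']
    split_ifs with h
    · rfl
    · refine ((mem_homogeneousSubmodule _ _).1 (u x).2).coeff_eq_zero ?_
      rintro rfl
      simp [S, Finset.mem_finsuppAntidiag, Finsupp.degree_eq_sum] at h
  have h2 : ∀ x, φ (u x) = ∑ ν : S, (u x : MvPolynomial (Fin 3) k).coeff ν.1 *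
      φ ⟨monomial ν.1 1, hS _ ν.2⟩ := by
    intro x
    conv_lhs => rw [key x]
    simp only [map_sum, map_smul, smul_eq_mul]
  simp only [h2]
  exact IsPolyFun.sum _ fun ν _ => (hu.coeff ν.1).mul (IsPolyFun.const _)

end IsPolyFam

end Families

/-! ### Linear forms -/

section Linear

variable {k : Type*} [Field k]

instance (d : ℕ) : Module.Finite k (Form k d) :=
  Module.Finite.iff_fg.2 (homogeneousSubmodule_fg _ _ d)

/-- The vector of the coefficients of a linear form. -/
noncomputable def coeffs : Form k 1 →ₗ[k] Fin 3 → k where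
  toFun l i := (l : MvPolynomial (Fin 3) k).coeff (Finsupp.single i 1)
  map_add' _ _ := by ext; simp
  map_smul' _ _ := by ext; simp

lemma coe_eq_sum (l : Form k 1) : (l : MvPolynomial (Fin 3) k) = ∑ i, C (coeffs l i) * X i := by
  ext ν
  simp only [coeff_sum, coeff_C_mul, coeff_X]
  by_cases h : ν.degree = 1
  · obtain ⟨i, rfl⟩ : ν ∈ Set.range (fun a : Fin 3 => Finsupp.single a 1) := by
      rw [Finsupp.range_single_one]
      exact h
    simp [Finsupp.single_left_inj, coeffs]
  · rw [((mem_homogeneousSubmodule _ _).1 l.2).coeff_eq_zero h, Finset.sum_eq_zero]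
    intro i _
    rw [if_neg, mul_zero]
    rintro rfl
    simp at h

lemma coeffs_injective : Function.Injective (coeffs (k := k)) := fun l m h =>
  Subtype.ext (by rw [coe_eq_sum, coe_eq_sum, h])

lemma eval_eq_dotProduct (l : Form k 1) (u : Fin 3 → k) :
    eval u (l : MvPolynomial (Fin 3) k) = coeffs l ⬝ᵥ u := by
  rw [coe_eq_sum]
  simp [dotProduct]

/-- The linear form with given coefficients. -/
noncomputable def ofCoeffs (a : Fin 3 → k) : Form k 1 :=
  ⟨∑ i, C (a i) * X i, Submodule.sum_mem _ fun _ _ => isHomogeneous_C_mul_X _ _⟩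

@[simp] lemma coeffs_ofCoeffs (a : Fin 3 → k) : coeffs (ofCoeffs a) = a := by
  ext i
  simp [coeffs, ofCoeffs, coeff_sum, coeff_C_mul, coeff_X, Finsupp.single_left_inj]

@[simp] lemma pderiv_linear (l : Form k 1) (i : Fin 3) :
    pderiv i (l : MvPolynomial (Fin 3) k) = C (coeffs l i) := by
  rw [coe_eq_sum, map_sum, Finset.sum_eq_single i]
  · simp
  · intro j _ hj
    simp [pderiv_X, hj.symm]
  · simp

lemma linearIndependent_iff_cross (l m : Form k 1) :
    LinearIndependent k ![l, m] ↔ crossProduct (coeffs l) (coeffs m) ≠ 0 := by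
  rw [crossProduct_ne_zero_iff_linearIndependent,
    ← LinearMap.linearIndependent_iff_of_injOn coeffs coeffs_injective.injOn]
  congr! 1
  ext i
  fin_cases i <;> rfl

end Linear

/-! ### The parametrization of `ℙ(V_n)_nod` by triples -/

section Triples

variable {k : Type*} [Field k]

/-- The product of two linear forms. -/
noncomputable def prodForm (l m : Form k 1) : Form k 2 := ⟨l * m, IsHomogeneous.mul l.2 m.2⟩

@[simp] lemma coe_prodForm (l m : Form k 1) :
    (prodForm l m : MvPolynomial (Fin 3) k) = l * m := rfl

lemma prodForm_ne_zero {l m : Form k 1} (hl : l ≠ 0) (hm : m ≠ 0) : prodForm l m ≠ 0 := by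
  intro h
  have h' : (l : MvPolynomial (Fin 3) k) * m = 0 := congrArg Subtype.val h
  rcases mul_eq_zero.1 h' with h | h
  · exact hl (Subtype.ext h)
  · exact hm (Subtype.ext h)

lemma prodForm_smul_smul {c d : k} (h : c * d = 1) (l m : Form k 1) :
    prodForm (c • l) (d • m) = prodForm l m :=
  Subtype.ext (by
    change c • (l : MvPolynomial (Fin 3) k) * d • (m : MvPolynomial (Fin 3) k) = l * m
    rw [smul_mul_smul_comm, h, one_smul])

lemma prodForm_comm (l m : Form k 1) : prodForm l m = prodForm m l :=
  Subtype.ext (mul_comm _ _)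

lemma mem_multiples {n : ℕ} {q : Form k 2} {f : Form k n} :
    f ∈ multiples n q ↔ ∃ g : Form k (n - 2),
      (g : MvPolynomial (Fin 3) k) * q = f :=
  ⟨fun ⟨g, hg, h⟩ => ⟨⟨g, hg⟩, h⟩, fun ⟨g, h⟩ => ⟨g, g.2, h⟩⟩

lemma proj_eq_iff {n : ℕ} {p p' : Pairs k n} :
    proj p = proj p' ↔ p.1.1 = p'.1.1 ∧
      ∃ c : k, c ≠ 0 ∧ p'.1.2 - c • p.1.2 ∈ multiples n p.1.1 := by
  obtain ⟨⟨q, f⟩, hq, hf⟩ := p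
  obtain ⟨⟨q', f'⟩, hq', hf'⟩ := p'
  constructor
  · intro h
    obtain rfl : q = q' := congrArg (fun x : PV k n => x.1.1) h
    refine ⟨rfl, ?_⟩
    have h2 := eq_of_heq (Sigma.mk.inj h).2
    obtain ⟨a, ha⟩ := (Projectivization.mk_eq_mk_iff k _ _ _ _).1 h2.symm
    refine ⟨a, a.ne_zero, ?_⟩
    rw [← Submodule.Quotient.mk_eq_zero, Submodule.Quotient.mk_sub, sub_eq_zero]
    exact ha.symm
  · rintro ⟨h, c, hc, hm⟩
    obtain rfl : q = q' := h
    refine Sigma.ext rfl (heq_of_eq ?_)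
    refine ((Projectivization.mk_eq_mk_iff k _ _ _ _).2 ⟨Units.mk0 c hc, ?_⟩).symm
    rw [← Submodule.Quotient.mk_eq_zero, Submodule.Quotient.mk_sub, sub_eq_zero] at hm
    exact hm.symm

lemma totalDegree_linear {l : Form k 1} (hl : l ≠ 0) :
    (l : MvPolynomial (Fin 3) k).totalDegree = 1 :=
  IsHomogeneous.totalDegree ((mem_homogeneousSubmodule _ _).1 l.2) (fun h => hl (Subtype.ext h))

lemma prime_linear {l : Form k 1} (hl : l ≠ 0) : Prime (l : MvPolynomial (Fin 3) k) := by
  refine (irreducible_of_totalDegree_eq_one (totalDegree_linear hl) fun x hx => ?_).prime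
  refine isUnit_iff_ne_zero.2 ?_
  rintro rfl
  refine hl (Subtype.ext (ext _ _ fun ν => ?_))
  simpa using hx ν

lemma exists_smul_of_dvd {l m : Form k 1} (hm : m ≠ 0)
    (h : (m : MvPolynomial (Fin 3) k) ∣ l) : ∃ c : k, l = c • m := by
  by_cases hl : l = 0
  · exact ⟨0, by simp [hl]⟩
  obtain ⟨a, ha⟩ := h
  have hm0 : (m : MvPolynomial (Fin 3) k) ≠ 0 := fun h => hm (Subtype.ext h)
  have ha0 : a ≠ 0 := by
    rintro rfl
    exact hl (Subtype.ext (by simpa using ha))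
  have := totalDegree_mul_of_isDomain hm0 ha0
  rw [← ha, totalDegree_linear hl, totalDegree_linear hm] at this
  have h0 : a.totalDegree = 0 := by omega
  refine ⟨a.coeff 0, Subtype.ext ?_⟩
  rw [ha, totalDegree_eq_zero_iff_eq_C.1 h0]
  simp [smul_eq_C_mul, mul_comm]

/-- Nonzero linear forms are prime, so `m₁` divides `l₁` or `l₂`, and the quotient is a constant for
reasons of degree. -/
lemma factorization_unique {l₁ l₂ m₁ m₂ : Form k 1} (hm : m₁ ≠ 0) (hm' : m₂ ≠ 0)
    (h : prodForm l₁ l₂ = prodForm m₁ m₂) :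
    ∃ c : k, c ≠ 0 ∧ (l₁ = c • m₁ ∧ l₂ = c⁻¹ • m₂ ∨ l₁ = c • m₂ ∧ l₂ = c⁻¹ • m₁) := by
  have key : ∀ {l₁ l₂ m₁ m₂ : Form k 1}, m₁ ≠ 0 → m₂ ≠ 0 → prodForm l₁ l₂ = prodForm m₁ m₂ →
      (m₁ : MvPolynomial (Fin 3) k) ∣ l₁ → ∃ c : k, c ≠ 0 ∧ l₁ = c • m₁ ∧ l₂ = c⁻¹ • m₂ := by
    intro l₁ l₂ m₁ m₂ hm hm' h hd
    obtain ⟨c, rfl⟩ := exists_smul_of_dvd hm hd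
    have h' : ((c • m₁ : Form k 1) : MvPolynomial (Fin 3) k) * l₂ = m₁ * m₂ :=
      congrArg Subtype.val h
    have h2 : c • l₂ = m₂ := by
      refine Subtype.ext (mul_left_cancel₀ (prime_linear hm).ne_zero (h'.symm ▸ ?_))
      simp
    have hc : c ≠ 0 := by
      rintro rfl
      exact hm' (by simpa using h2.symm)
    exact ⟨c, hc, rfl, by rw [← h2, smul_smul, inv_mul_cancel₀ hc, one_smul]⟩
  have h' : (l₁ : MvPolynomial (Fin 3) k) * l₂ = m₁ * m₂ := congrArg Subtype.val h
  rcases (prime_linear hm).dvd_or_dvd (h'.symm ▸ dvd_mul_right _ _ :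
    (m₁ : MvPolynomial (Fin 3) k) ∣ l₁ * l₂) with hd | hd
  · obtain ⟨c, hc, h1, h2⟩ := key hm hm' h hd
    exact ⟨c, hc, Or.inl ⟨h1, h2⟩⟩
  · rw [prodForm_comm] at h
    obtain ⟨c, hc, h1, h2⟩ := key hm hm' h hd
    exact ⟨c⁻¹, inv_ne_zero hc, Or.inr ⟨h2, by rw [inv_inv]; exact h1⟩⟩

lemma LinearIndependent.pair_smul_smul {l m : Form k 1} (h : LinearIndependent k ![l, m])
    {c d : k} (hc : c ≠ 0) (hd : d ≠ 0) : LinearIndependent k ![c • l, d • m] := by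
  rw [linearIndependent_iff_cross] at h ⊢
  simpa [hc, hd] using h

lemma LinearIndependent.pair_swap {l m : Form k 1} (h : LinearIndependent k ![l, m]) :
    LinearIndependent k ![m, l] := by
  rw [linearIndependent_iff_cross] at h ⊢
  rwa [← cross_anticomm, neg_ne_zero]

lemma LinearIndependent.pair_ne_zero {l m : Form k 1} (h : LinearIndependent k ![l, m]) :
    l ≠ 0 ∧ m ≠ 0 :=
  ⟨h.ne_zero 0, h.ne_zero 1⟩

lemma linearIndependent_of_prodForm_eq {l₁ l₂ m₁ m₂ : Form k 1}
    (hm : LinearIndependent k ![m₁, m₂]) (h : prodForm l₁ l₂ = prodForm m₁ m₂) :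
    LinearIndependent k ![l₁, l₂] := by
  obtain ⟨h1, h2⟩ := LinearIndependent.pair_ne_zero hm
  obtain ⟨c, hc, ⟨rfl, rfl⟩ | ⟨rfl, rfl⟩⟩ := factorization_unique h1 h2 h
  · exact LinearIndependent.pair_smul_smul hm hc (inv_ne_zero hc)
  · exact LinearIndependent.pair_swap (LinearIndependent.pair_smul_smul hm (inv_ne_zero hc) hc)

variable (k) in
/-- The space of the triples `(l₁, l₂, f)` of two linear forms and a form of degree `n`. -/
abbrev TripleSpace (n : ℕ) : Type _ := Form k 1 × Form k 1 × Form k n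

variable (k) in
/-- The triples `(l₁, l₂, f)` such that `l₁` and `l₂` are linearly independent and `f` is not a
multiple of `l₁ l₂`. -/
def Triples (n : ℕ) : Type _ :=
  {t : TripleSpace k n // LinearIndependent k ![t.1, t.2.1] ∧
    t.2.2 ∉ multiples n (prodForm t.1 t.2.1)}

/-- The inclusion of the triples in their ambient vector space. -/
noncomputable def Triples.val {n : ℕ} (t : Triples k n) : Aff k (TripleSpace k n) := Subtype.val t

/-- The first linear form of a triple. -/
noncomputable def fstForm (n : ℕ) : TripleSpace k n →ₗ[k] Form k 1 := LinearMap.fst k _ _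

/-- The second linear form of a triple. -/
noncomputable def sndForm (n : ℕ) : TripleSpace k n →ₗ[k] Form k 1 :=
  LinearMap.fst k _ _ ∘ₗ LinearMap.snd k _ _

/-- The form of degree `n` of a triple. -/
noncomputable def trdForm (n : ℕ) : TripleSpace k n →ₗ[k] Form k n :=
  LinearMap.snd k _ _ ∘ₗ LinearMap.snd k _ _

noncomputable instance (n : ℕ) : TopologicalSpace (Triples k n) :=
  TopologicalSpace.induced Triples.val inferInstance

/-- The pair `(l₁ l₂, f)`. -/
noncomputable def Triples.pair {n : ℕ} (t : Triples k n) : Pairs k n :=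
  ⟨(prodForm t.1.1 t.1.2.1, t.1.2.2), prodForm_ne_zero (LinearIndependent.pair_ne_zero t.2.1).1
    (LinearIndependent.pair_ne_zero t.2.1).2, t.2.2⟩

/-- The point `(l₁ l₂, [f])` of `ℙ(V_n)_nod`. -/
noncomputable def Triples.point {n : ℕ} (t : Triples k n) : PVnod k n :=
  ⟨proj t.pair, t.1.1, t.1.2.1, t.2.1, rfl⟩

lemma isPolyFam_prodForm {E : Type*} [AddCommGroup E] [Module k E] (L M : E →ₗ[k] Form k 1) :
    IsPolyFam fun x => (prodForm (L x) (M x) : MvPolynomial (Fin 3) k) :=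
  (IsPolyFam.of_linear L).mul (IsPolyFam.of_linear M)

lemma Triples.continuous_pair (n : ℕ) : Continuous (Triples.pair : Triples k n → Pairs k n) := by
  have h : IsPolyMap (k := k) (E := TripleSpace k n) (F := Form k 2 × Form k n)
      fun t => (prodForm t.1 t.2.1, t.2.2) := IsPolyMap.prodMk
    (IsPolyFam.isPolyMap (isPolyFam_prodForm (fstForm n) (sndForm n)))
    (IsPolyMap.of_linear (trdForm n))
  exact continuous_induced_rng.2 (h.continuous.comp continuous_induced_dom)

lemma continuous_proj (n : ℕ) : Continuous (proj : Pairs k n → PV k n) :=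
  continuous_coinduced_rng

lemma Triples.continuous_point (n : ℕ) :
    Continuous (Triples.point : Triples k n → PVnod k n) :=
  continuous_induced_rng.2 ((continuous_proj n).comp (Triples.continuous_pair n))

lemma Triples.point_surjective (n : ℕ) :
    Function.Surjective (Triples.point : Triples k n → PVnod k n) := by
  rintro ⟨x, l₁, l₂, hl, h⟩
  obtain ⟨p, rfl⟩ := proj_surjective n x
  have hq : p.1.1 = prodForm l₁ l₂ := Subtype.ext h
  refine ⟨⟨(l₁, l₂, p.1.2), hl, hq ▸ p.2.2⟩, Subtype.ext (congrArg proj (Subtype.ext ?_))⟩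
  exact Prod.ext hq.symm rfl

lemma Triples.point_eq_iff {n : ℕ} {t t' : Triples k n} :
    t.point = t'.point ↔ prodForm t.1.1 t.1.2.1 = prodForm t'.1.1 t'.1.2.1 ∧
      ∃ c : k, c ≠ 0 ∧ t'.1.2.2 - c • t.1.2.2 ∈ multiples n (prodForm t.1.1 t.1.2.1) := by
  rw [Subtype.ext_iff]
  exact proj_eq_iff

end Triples

/-! ### Triples as an open set, and the transformations along the fibres of the parametrization -/

section OpenMap

variable {k : Type*} [Field k]

lemma isPolyFun_coeffs {E : Type*} [AddCommGroup E] [Module k E] (L : E →ₗ[k] Form k 1)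
    (i : Fin 3) : IsPolyFun fun x => coeffs (L x) i :=
  IsPolyFun.linear (LinearMap.proj i ∘ₗ coeffs ∘ₗ L)

lemma IsPolyFun.cross {E : Type*} [AddCommGroup E] [Module k E] {a b : E → Fin 3 → k}
    (ha : ∀ i, IsPolyFun fun x => a x i) (hb : ∀ i, IsPolyFun fun x => b x i) (i : Fin 3) :
    IsPolyFun fun x => crossProduct (a x) (b x) i := by
  have h : ∀ i j : Fin 3, IsPolyFun fun x => a x i * b x j - a x j * b x i := fun i j =>
    ((ha i).mul (hb j)).sub ((ha j).mul (hb i))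
  fin_cases i
  · simpa [cross_apply] using h 1 2
  · simpa [cross_apply] using h 2 0
  · simpa [cross_apply] using h 0 1

/-- The coordinates of the intersection point of two lines are polynomial functions. -/
lemma isPolyFun_cross {E : Type*} [AddCommGroup E] [Module k E] (L M : E →ₗ[k] Form k 1)
    (i : Fin 3) : IsPolyFun fun x => crossProduct (coeffs (L x)) (coeffs (M x)) i :=
  IsPolyFun.cross (isPolyFun_coeffs L) (isPolyFun_coeffs M) i

lemma Triples.mem_range_val {n : ℕ} {t : TripleSpace k n} :
    t ∈ Set.range (Triples.val : Triples k n → Aff k (TripleSpace k n)) ↔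
      LinearIndependent k ![t.1, t.2.1] ∧ t.2.2 ∉ multiples n (prodForm t.1 t.2.1) :=
  ⟨fun ⟨s, hs⟩ => hs ▸ s.2, fun h => ⟨⟨t, h⟩, rfl⟩⟩

/-- For independent `l₁, l₂`, the form `f` is a multiple of `l₁ l₂` exactly when `a f = g l₁ l₂` for
some `(g, a) ≠ 0`, as `l₁ l₂ ≠ 0` excludes `a = 0`. This condition is homogeneous in `(g, a)`, so
elimination applies; independence is the nonvanishing of the cross product. -/
lemma Triples.isOpen_range_val [IsAlgClosed k] (n : ℕ) :
    IsOpen (Set.range (Triples.val : Triples k n → Aff k (TripleSpace k n))) := by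
  let E := TripleSpace k n
  let V := Form k (n - 2) × k
  let L₁ : E × V →ₗ[k] E := LinearMap.fst k E V
  let L₂ : E × V →ₗ[k] V := LinearMap.snd k E V
  have hG : IsPolyFam fun p : E × V => C (p.2.2) * (p.1.2.2 : MvPolynomial (Fin 3) k) -
      (p.2.1 : MvPolynomial (Fin 3) k) * (prodForm p.1.1 p.1.2.1 : MvPolynomial (Fin 3) k) :=
    ((IsPolyFam.of_isPolyFun (IsPolyFun.linear (LinearMap.snd k _ _ ∘ₗ L₂))).mul
      (IsPolyFam.of_linear (trdForm n ∘ₗ L₁))).sub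
      ((IsPolyFam.of_linear (LinearMap.fst k _ _ ∘ₗ L₂)).mul
        (isPolyFam_prodForm (fstForm n ∘ₗ L₁) (sndForm n ∘ₗ L₁)))
  have h1 := isClosed_elimination hG.isClosed (by
    rintro x ⟨g, a⟩ h c hc
    have h' : C a * (x.2.2 : MvPolynomial (Fin 3) k) -
      (g : MvPolynomial (Fin 3) k) * (prodForm x.1 x.2.1 : MvPolynomial (Fin 3) k) = 0 := h
    change C (c * a) * (x.2.2 : MvPolynomial (Fin 3) k) -
      (c • (g : MvPolynomial (Fin 3) k)) * (prodForm x.1 x.2.1 : MvPolynomial (Fin 3) k) = 0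
    rw [smul_eq_C_mul, C_mul, mul_assoc, mul_assoc, ← mul_sub, h', mul_zero])
  have h2 : IsClosed (X := Aff k E) {t : E | ∀ i, crossProduct (coeffs t.1) (coeffs t.2.1) i = 0} :=
    isClosed_of_forall_isPolyFun fun i => isPolyFun_cross (fstForm n) (sndForm n) i
  convert (h1.union h2).isOpen_compl using 1
  refine Set.ext fun (t : E) => ?_
  refine Triples.mem_range_val.trans ⟨?_, fun hc => ?_⟩
  · rintro ⟨hl, hf⟩
    rintro (⟨⟨g, a⟩, hga, h⟩ | h)
    swap
    · exact (linearIndependent_iff_cross _ _).1 hl (funext h)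
    have h' : C a * (t.2.2 : MvPolynomial (Fin 3) k) -
      (g : MvPolynomial (Fin 3) k) * (prodForm t.1 t.2.1 : MvPolynomial (Fin 3) k) = 0 := h
    by_cases ha : a = 0
    · obtain ⟨hl1, hl2⟩ := LinearIndependent.pair_ne_zero hl
      rw [ha, C_0, zero_mul, zero_sub, neg_eq_zero, mul_eq_zero] at h'
      rcases h' with h' | h'
      · exact hga (Prod.ext (Subtype.ext h') ha)
      · exact prodForm_ne_zero hl1 hl2 (Subtype.ext h')
    · refine hf (mem_multiples.2 ⟨a⁻¹ • g, ?_⟩)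
      rw [sub_eq_zero] at h'
      change (a⁻¹ • (g : MvPolynomial (Fin 3) k)) * _ = _
      rw [smul_mul_assoc, ← h', smul_eq_C_mul, ← mul_assoc, ← C_mul, inv_mul_cancel₀ ha, C_1,
        one_mul]
  · refine ⟨(linearIndependent_iff_cross _ _).2 fun h => hc (Or.inr fun i => congrFun h i),
      fun h => hc (Or.inl ?_)⟩
    obtain ⟨g, hg⟩ := mem_multiples.1 h
    refine ⟨(g, 1), fun h => one_ne_zero (congrArg Prod.snd h), ?_⟩
    change C 1 * (t.2.2 : MvPolynomial (Fin 3) k) -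
      (g : MvPolynomial (Fin 3) k) * (prodForm t.1 t.2.1 : MvPolynomial (Fin 3) k) = 0
    rw [hg, C_1, one_mul, sub_self]

lemma Triples.val_injective (n : ℕ) :
    Function.Injective (Triples.val : Triples k n → Aff k (TripleSpace k n)) :=
  Subtype.val_injective

lemma Triples.isOpenEmbedding_val [IsAlgClosed k] (n : ℕ) :
    Topology.IsOpenEmbedding (Triples.val : Triples k n → Aff k (TripleSpace k n)) :=
  ⟨⟨⟨rfl⟩, Triples.val_injective n⟩, Triples.isOpen_range_val n⟩

lemma Triples.continuous_val (n : ℕ) :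
    Continuous (Triples.val : Triples k n → Aff k (TripleSpace k n)) :=
  continuous_induced_dom

lemma Triples.continuous_of_isPolyMap {n : ℕ} {τ : Triples k n → Triples k n}
    {u : TripleSpace k n → TripleSpace k n} (hu : IsPolyMap (k := k) u)
    (h : ∀ t, (τ t).1 = u t.1) : Continuous τ := by
  refine continuous_induced_rng.2 ?_
  have := hu.continuous.comp (Triples.continuous_val n)
  convert this using 1
  exact funext h

/-- The product of a form of degree `n - 2` and a quadratic form. -/
noncomputable def mulQuad {n : ℕ} (hn : 2 ≤ n) (g : Form k (n - 2)) (q : Form k 2) : Form k n :=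
  ⟨g * q, by
    have := IsHomogeneous.mul g.2 q.2
    rwa [Nat.sub_add_cancel hn] at this⟩

lemma mulQuad_mem {n : ℕ} (hn : 2 ≤ n) (g : Form k (n - 2)) (q : Form k 2) :
    mulQuad hn g q ∈ multiples n q :=
  mem_multiples.2 ⟨g, rfl⟩

/-- The transformation `(l₁, l₂, f) ↦ (c l₁, c⁻¹ l₂, a f + g l₁ l₂)`. -/
noncomputable def rescaleTriple {n : ℕ} (hn : 2 ≤ n) (c a : k) (g : Form k (n - 2))
    (t : TripleSpace k n) : TripleSpace k n :=
  (c • t.1, c⁻¹ • t.2.1, a • t.2.2 + mulQuad hn g (prodForm t.1 t.2.1))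

lemma isPolyMap_rescale {n : ℕ} (hn : 2 ≤ n) (c a : k) (g : Form k (n - 2)) :
    IsPolyMap (k := k) (rescaleTriple hn c a g) := by
  have h : IsPolyMap (k := k) fun t : TripleSpace k n => mulQuad hn g (prodForm t.1 t.2.1) :=
    IsPolyFam.isPolyMap ((IsPolyFam.const (g : MvPolynomial (Fin 3) k)).mul
      (isPolyFam_prodForm (fstForm n) (sndForm n)))
  exact (IsPolyMap.of_linear (c • fstForm n)).prodMk
    ((IsPolyMap.of_linear (c⁻¹ • sndForm n)).prodMk ((IsPolyMap.of_linear (a • trdForm n)).add h))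

lemma prodForm_rescale {n : ℕ} (hn : 2 ≤ n) {c : k} (hc : c ≠ 0) (a : k) (g : Form k (n - 2))
    (t : TripleSpace k n) :
    prodForm (rescaleTriple hn c a g t).1 (rescaleTriple hn c a g t).2.1 = prodForm t.1 t.2.1 :=
  prodForm_smul_smul (mul_inv_cancel₀ hc) _ _

lemma smul_add_mem_multiples_iff {n : ℕ} {q : Form k 2} {f h : Form k n} {a : k} (ha : a ≠ 0)
    (hh : h ∈ multiples n q) : a • f + h ∈ multiples n q ↔ f ∈ multiples n q := by
  rw [Submodule.add_mem_iff_left _ hh, Submodule.smul_mem_iff _ ha]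

/-- The transformation of the triples given by `rescaleTriple`. -/
noncomputable def Triples.rescale {n : ℕ} (hn : 2 ≤ n) {c a : k} (hc : c ≠ 0) (ha : a ≠ 0)
    (g : Form k (n - 2)) (t : Triples k n) : Triples k n :=
  ⟨rescaleTriple hn c a g t.1,
    LinearIndependent.pair_smul_smul t.2.1 hc (inv_ne_zero hc), by
      rw [prodForm_rescale hn hc]
      exact fun h => t.2.2 ((smul_add_mem_multiples_iff ha (mulQuad_mem hn g _)).1 h)⟩

lemma Triples.continuous_rescale {n : ℕ} (hn : 2 ≤ n) {c a : k} (hc : c ≠ 0) (ha : a ≠ 0)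
    (g : Form k (n - 2)) : Continuous (Triples.rescale hn hc ha g) :=
  Triples.continuous_of_isPolyMap (isPolyMap_rescale hn c a g) fun _ => rfl

lemma Triples.point_rescale {n : ℕ} (hn : 2 ≤ n) {c a : k} (hc : c ≠ 0) (ha : a ≠ 0)
    (g : Form k (n - 2)) (t : Triples k n) : (Triples.rescale hn hc ha g t).point = t.point := by
  symm
  rw [Triples.point_eq_iff]
  refine ⟨(prodForm_rescale hn hc a g t.1).symm, a, ha, ?_⟩
  change a • t.1.2.2 + mulQuad hn g (prodForm t.1.1 t.1.2.1) - a • t.1.2.2 ∈ _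
  rw [add_sub_cancel_left]
  exact mulQuad_mem hn g _

/-- The transformation `(l₁, l₂, f) ↦ (l₂, l₁, f)`. -/
noncomputable def Triples.swap {n : ℕ} (t : Triples k n) : Triples k n :=
  ⟨(t.1.2.1, t.1.1, t.1.2.2), LinearIndependent.pair_swap t.2.1, by
    rw [prodForm_comm]
    exact t.2.2⟩

lemma Triples.continuous_swap (n : ℕ) : Continuous (Triples.swap : Triples k n → Triples k n) := by
  have h : IsPolyMap (k := k) fun t : TripleSpace k n => ((t.2.1, t.1, t.2.2) : TripleSpace k n) :=
    (IsPolyMap.of_linear (sndForm n)).prodMk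
      ((IsPolyMap.of_linear (fstForm n)).prodMk (IsPolyMap.of_linear (trdForm n)))
  exact Triples.continuous_of_isPolyMap h fun _ => rfl

lemma Triples.point_swap {n : ℕ} (t : Triples k n) : t.swap.point = t.point := by
  symm
  rw [Triples.point_eq_iff]
  refine ⟨prodForm_comm _ _, 1, one_ne_zero, ?_⟩
  change t.1.2.2 - (1 : k) • t.1.2.2 ∈ _
  simp

/-- Continuous maps over `PVnod` move any point of a fibre to any other: unique factorization leaves
only a scaling and an exchange of the lines, and two representatives of `[f]` differ by a scalar and
a multiple of `l₁ l₂`. -/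
lemma Triples.exists_continuous {n : ℕ} (hn : 2 ≤ n) {t t' : Triples k n}
    (h : t.point = t'.point) : ∃ τ : Triples k n → Triples k n, Continuous τ ∧
      (∀ s, (τ s).point = s.point) ∧ τ t = t' := by
  obtain ⟨hq, a, ha, hm⟩ := Triples.point_eq_iff.1 h
  obtain ⟨g, hg⟩ := mem_multiples.1 hm
  have hg' : mulQuad hn g (prodForm t.1.1 t.1.2.1) = t'.1.2.2 - a • t.1.2.2 := Subtype.ext hg
  obtain ⟨h1, h2⟩ := LinearIndependent.pair_ne_zero t.2.1
  obtain ⟨c, hc, ⟨e1, e2⟩ | ⟨e1, e2⟩⟩ := factorization_unique h1 h2 hq.symm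
  · refine ⟨Triples.rescale hn hc ha g, Triples.continuous_rescale hn hc ha g,
      Triples.point_rescale hn hc ha g, Subtype.ext (Prod.ext e1.symm (Prod.ext e2.symm ?_))⟩
    change a • t.1.2.2 + mulQuad hn g (prodForm t.1.1 t.1.2.1) = t'.1.2.2
    rw [hg', add_sub_cancel]
  · refine ⟨fun s => Triples.rescale hn hc ha g s.swap,
      (Triples.continuous_rescale hn hc ha g).comp (Triples.continuous_swap n),
      fun s => (Triples.point_rescale hn hc ha g _).trans s.point_swap,
      Subtype.ext (Prod.ext e1.symm (Prod.ext e2.symm ?_))⟩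
    change a • t.1.2.2 + mulQuad hn g (prodForm t.1.2.1 t.1.1) = t'.1.2.2
    rw [prodForm_comm, hg', add_sub_cancel]

end OpenMap

/-! ### Openness of the parametrization -/

section OpenMap

variable {k : Type*} [Field k]

/-- Two vectors are proportional if their images under all pairs of linear forms are. -/
lemma exists_smul_eq_of_forall_dual {V : Type*} [AddCommGroup V] [Module k V] {p q : V}
    (hp : p ≠ 0) (h : ∀ φ ψ : Module.Dual k V, φ q * ψ p - ψ q * φ p = 0) :
    ∃ ψ : Module.Dual k V, ψ p ≠ 0 ∧ q = (ψ q / ψ p) • p := by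
  obtain ⟨ψ, hψ⟩ : ∃ ψ : Module.Dual k V, ψ p ≠ 0 := by
    by_contra! hc
    exact hp ((Module.forall_dual_apply_eq_zero_iff k p).1 hc)
  refine ⟨ψ, hψ, ?_⟩
  rw [← sub_eq_zero, ← Module.forall_dual_apply_eq_zero_iff k]
  intro φ
  have := h φ ψ
  rw [map_sub, map_smul, smul_eq_mul]
  field_simp
  linear_combination this

section Spread

variable {n : ℕ}

/-- For a set `Z` of triples `(l₁, l₂, f)`, the set of the `(q, f, l₁, l₂)` such that `q` is
proportional to `l₁ l₂`, and such that the triple obtained from `(l₁, l₂, f)` by scaling `l₁` to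
get `q = l₁ l₂` belongs to `Z`. -/
def spread (Z : Set (Aff k (TripleSpace k n))) :
    Set (Aff k (((Form k 2 × Form k n) × Form k 1) × Form k 1)) :=
  {x : ((Form k 2 × Form k n) × Form k 1) × Form k 1 |
    (∀ φ ψ : Module.Dual k (Form k 2),
      φ x.1.1.1 * ψ (prodForm x.1.2 x.2) - ψ x.1.1.1 * φ (prodForm x.1.2 x.2) = 0) ∧
    ∀ ψ : Module.Dual k (Form k 2), ψ (prodForm x.1.2 x.2) ≠ 0 →
      (((ψ x.1.1.1 / ψ (prodForm x.1.2 x.2)) • x.1.2, x.2, x.1.1.2) : TripleSpace k n) ∈ Z}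

lemma mem_spread {Z : Set (Aff k (TripleSpace k n))} {q : Form k 2} {f : Form k n}
    {l m : Form k 1} : (((q, f), l), m) ∈ spread Z ↔
    (∀ φ ψ : Module.Dual k (Form k 2), φ q * ψ (prodForm l m) - ψ q * φ (prodForm l m) = 0) ∧
    ∀ ψ : Module.Dual k (Form k 2), ψ (prodForm l m) ≠ 0 →
      (((ψ q / ψ (prodForm l m)) • l, m, f) : TripleSpace k n) ∈ Z :=
  Iff.rfl

/-- Proportionality is given by polynomial equations. The other conditions involve the quotient by
`ψ (l m)`, and `isClosed_preimage_quotient` applies with this denominator. -/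
lemma isClosed_spread {Z : Set (Aff k (TripleSpace k n))} (hZ : IsClosed Z) :
    IsClosed (spread Z) := by
  let E := ((Form k 2 × Form k n) × Form k 1) × Form k 1
  let L : E →ₗ[k] Form k 1 := LinearMap.snd k _ _ ∘ₗ LinearMap.fst k _ _
  let M : E →ₗ[k] Form k 1 := LinearMap.snd k _ _
  let q : E →ₗ[k] Form k 2 := LinearMap.fst k _ _ ∘ₗ LinearMap.fst k _ _ ∘ₗ LinearMap.fst k _ _
  let f : E →ₗ[k] Form k n := LinearMap.snd k _ _ ∘ₗ LinearMap.fst k _ _ ∘ₗ LinearMap.fst k _ _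
  have hLM : IsPolyMap (k := k) fun x => prodForm (L x) (M x) :=
    IsPolyFam.isPolyMap (isPolyFam_prodForm L M)
  have hq : ∀ φ : Module.Dual k (Form k 2), IsPolyFun fun x => φ (q x) := fun φ =>
    IsPolyFun.linear (φ ∘ₗ q)
  have h1 : IsClosed (X := Aff k E) {x : E | ∀ φ : Module.Dual k (Form k 2) ×
      Module.Dual k (Form k 2), φ.1 (q x) * φ.2 (prodForm (L x) (M x)) -
        φ.2 (q x) * φ.1 (prodForm (L x) (M x)) = 0} :=
    isClosed_of_forall_isPolyFun fun φ =>
      ((hq φ.1).mul (hLM φ.2)).sub ((hq φ.2).mul (hLM φ.1))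
  have h2 : ∀ ψ : Module.Dual k (Form k 2), IsClosed (X := Aff k E)
      {x : E | ψ (prodForm (L x) (M x)) ≠ 0 →
        (((ψ (q x) / ψ (prodForm (L x) (M x))) • L x, M x, f x) : TripleSpace k n) ∈ Z} := by
    intro ψ
    refine isClosed_preimage_quotient (u := fun x =>
      (((ψ (q x) / ψ (prodForm (L x) (M x))) • L x, M x, f x) : TripleSpace k n))
      (hLM ψ) (fun φ => ?_) hZ
    have hu : IsPolyMap (k := k) fun x => ((ψ (q x) • L x, ψ (prodForm (L x) (M x)) • M x,
        ψ (prodForm (L x) (M x)) • f x) : TripleSpace k n) :=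
      (IsPolyMap.smul (hq ψ) (IsPolyMap.of_linear L)).prodMk
        ((IsPolyMap.smul (hLM ψ) (IsPolyMap.of_linear M)).prodMk
          (IsPolyMap.smul (hLM ψ) (IsPolyMap.of_linear f)))
    refine ⟨_, hu φ, fun x hx => ?_⟩
    rw [← smul_eq_mul, ← map_smul, Prod.smul_mk, Prod.smul_mk, smul_smul, mul_div_cancel₀ _ hx]
  convert h1.inter (isClosed_iInter h2) using 1
  refine Set.ext fun (x : E) => ?_
  refine Iff.trans ?_ (and_congr Iff.rfl Set.mem_iInter.symm)
  exact and_congr ⟨fun h φ => h φ.1 φ.2, fun h φ ψ => h (φ, ψ)⟩ Iff.rfl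

variable [IsAlgClosed k]

/-- The image of a closed set of triples under `(l₁, l₂, f) ↦ (l₁ l₂, f)`, when the set is stable
under `(l₁, l₂, f) ↦ (c l₁, c⁻¹ l₂, f)`. -/
lemma exists_isClosed_image {Z : Set (Aff k (TripleSpace k n))} (hZ : IsClosed Z)
    (hZc : ∀ (l m : Form k 1) (f : Form k n), ((l, m, f) : TripleSpace k n) ∈ Z →
      ∀ c : k, c ≠ 0 → ((c • l, c⁻¹ • m, f) : TripleSpace k n) ∈ Z) :
    ∃ K : Set (Aff k (Form k 2 × Form k n)), IsClosed K ∧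
      ∀ (q : Form k 2) (f : Form k n), q ≠ 0 →
        ((q, f) ∈ K ↔ ∃ l m : Form k 1, ((l, m, f) : TripleSpace k n) ∈ Z ∧ prodForm l m = q) := by
  -- Eliminate `m`, then `l`. Replacing `m` by `c m` divides the factor in front of `l` by `c`, and
  -- the stability of `Z` absorbs this.
  have h1 := isClosed_elimination (isClosed_spread hZ) (by
    rintro ⟨⟨q, f⟩, l⟩ m h c hc
    rw [mem_spread] at h ⊢
    have hb : prodForm l (c • m) = c • prodForm l m := Subtype.ext (mul_smul_comm _ _ _)
    simp only [hb, map_smul, smul_eq_mul]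
    refine ⟨fun φ ψ => by linear_combination c * h.1 φ ψ, fun ψ hψ => ?_⟩
    have := hZc _ _ _ (h.2 ψ (right_ne_zero_of_mul hψ)) c⁻¹ (inv_ne_zero hc)
    rw [inv_inv, smul_smul] at this
    convert this using 3
    field_simp)
  -- Replacing `l` by `c l` changes nothing: the factor in front of it is divided by `c`.
  have h2 := isClosed_elimination h1 (by
    rintro ⟨q, f⟩ l ⟨m, hm, h⟩ c hc
    refine ⟨m, hm, ?_⟩
    rw [mem_spread] at h ⊢
    have hb : prodForm (c • l) m = c • prodForm l m := Subtype.ext (smul_mul_assoc _ _ _)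
    simp only [hb, map_smul, smul_eq_mul]
    refine ⟨fun φ ψ => by linear_combination c * h.1 φ ψ, fun ψ hψ => ?_⟩
    have := h.2 ψ (right_ne_zero_of_mul hψ)
    convert this using 2
    rw [smul_smul]
    congr 1
    field_simp)
  refine ⟨_, h2, fun q f hq => ⟨?_, ?_⟩⟩
  · rintro ⟨l, hl, m, hm, h⟩
    rw [mem_spread] at h
    obtain ⟨ψ, hψ, e⟩ := exists_smul_eq_of_forall_dual (prodForm_ne_zero hl hm) h.1
    refine ⟨_, _, h.2 ψ hψ, ?_⟩
    conv_rhs => rw [e]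
    exact Subtype.ext (smul_mul_assoc _ _ _)
  · rintro ⟨l, m, h, rfl⟩
    have hl : l ≠ 0 := by
      rintro rfl
      exact hq (Subtype.ext (zero_mul _))
    have hm : m ≠ 0 := by
      rintro rfl
      exact hq (Subtype.ext (mul_zero _))
    refine ⟨l, hl, m, hm, mem_spread.2 ⟨fun φ ψ => by ring, fun ψ hψ => ?_⟩⟩
    rwa [div_self hψ, one_smul]

end Spread

variable [IsAlgClosed k] {n : ℕ}

/-- The image in `ℙ(V_n)_nod` of a saturated closed set of triples is closed. -/
lemma Triples.isClosed_image_point (hn : 2 ≤ n) {Y : Set (Triples k n)} (hY : IsClosed Y)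
    (hsat : ∀ t ∈ Y, ∀ t' : Triples k n, t'.point = t.point → t' ∈ Y) :
    IsClosed (Triples.point '' Y) := by
  -- The closure is taken in the whole affine space because `exists_isClosed_image` needs a closed
  -- set there. Its trace on the triples is `Y`, and it inherits the stability of `Y` because the
  -- rescalings are polynomial on the whole space.
  set Z := closure (Triples.val '' Y)
  have hZY : ∀ t : Triples k n, t.val ∈ Z → t ∈ Y := fun t ht => by
    have := (Triples.isOpenEmbedding_val n).isInducing.closure_eq_preimage_closure_image Y
    rw [hY.closure_eq] at this
    exact this ▸ ht
  have hZs : ∀ {c a : k}, c ≠ 0 → a ≠ 0 → ∀ (g : Form k (n - 2)) (t : TripleSpace k n), t ∈ Z →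
      rescaleTriple hn c a g t ∈ Z := by
    intro c a hc ha g t ht
    refine map_mem_closure (X := Aff k (TripleSpace k n)) (Y := Aff k (TripleSpace k n))
      (isPolyMap_rescale hn c a g).continuous ht ?_
    rintro _ ⟨s, hs, rfl⟩
    exact ⟨s.rescale hn hc ha g, hsat s hs _ (Triples.point_rescale hn hc ha g s), rfl⟩
  have hmul0 : ∀ q : Form k 2, mulQuad hn 0 q = 0 := fun q => Subtype.ext (zero_mul _)
  obtain ⟨K, hK, hKiff⟩ := exists_isClosed_image (n := n) (Z := Z) isClosed_closure
    fun l m f h c hc => by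
      have := hZs hc one_ne_zero 0 _ h
      simpa [rescaleTriple, hmul0] using this
  -- The preimage of `S` among the pairs is the trace of `K`, since `Z` is stable under `f ↦ a f + g
  -- l m`. So `S` is closed in the quotient topology, and the image of `Y` is its trace on `PVnod`.
  let S : Set (PV k n) := {x | ∃ p : Pairs k n, proj p = x ∧ p.1 ∈ K}
  have hS : IsClosed S := by
    refine isClosed_coinduced.2 ?_
    have : proj ⁻¹' S = Subtype.val ⁻¹' K := by
      ext p
      refine ⟨?_, fun h => ⟨p, rfl, h⟩⟩
      rintro ⟨p', hpp, hp'⟩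
      obtain ⟨hq, a, ha, hm⟩ := proj_eq_iff.1 hpp
      obtain ⟨g, hg⟩ := mem_multiples.1 hm
      obtain ⟨l, m, hlm, hlq⟩ := (hKiff p'.1.1 p'.1.2 p'.2.1).1 hp'
      refine (hKiff p.1.1 p.1.2 p.2.1).2 ⟨l, m, ?_, hlq.trans hq⟩
      have := hZs one_ne_zero ha g _ hlm
      rw [rescaleTriple, one_smul, inv_one, one_smul] at this
      dsimp only at this
      rw [hlq, show mulQuad hn g p'.1.1 = p.1.2 - a • p'.1.2 from Subtype.ext hg,
        add_sub_cancel] at this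
      exact this
    rw [this]
    exact hK.preimage continuous_induced_dom
  have : Triples.point '' Y = Subtype.val ⁻¹' S := by
    ext x
    constructor
    · rintro ⟨t, ht, rfl⟩
      refine ⟨t.pair, rfl, (hKiff _ _ t.pair.2.1).2 ⟨t.1.1, t.1.2.1, ?_, rfl⟩⟩
      exact subset_closure (X := Aff k (TripleSpace k n)) ⟨t, ht, rfl⟩
    · rintro ⟨p, hpx, hpK⟩
      obtain ⟨l, m, hlm, hlq⟩ := (hKiff _ _ p.2.1).1 hpK
      obtain ⟨m₁, m₂, hmm, hxq⟩ := x.2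
      have hq : p.1.1 = prodForm m₁ m₂ := by
        refine Subtype.ext (Eq.trans ?_ hxq)
        rw [← hpx]
        rfl
      refine ⟨⟨(l, m, p.1.2), linearIndependent_of_prodForm_eq hmm (hlq.trans hq),
        hlq ▸ p.2.2⟩, hZY _ hlm, Subtype.ext (Eq.trans (congrArg proj ?_) hpx)⟩
      exact Subtype.ext (Prod.ext hlq rfl)
  rw [this]
  exact hS.preimage continuous_subtype_val

/-- The saturation of an open set is a union of preimages under the maps of
`Triples.exists_continuous`, hence open; its complement is closed and saturated, and so has a closed
image. -/
lemma Triples.isOpenMap_point (hn : 2 ≤ n) :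
    IsOpenMap (Triples.point : Triples k n → PVnod k n) := by
  intro U hU
  have hsat : IsOpen (Triples.point ⁻¹' (Triples.point '' U)) := by
    rw [isOpen_iff_forall_mem_open]
    rintro t ⟨t', ht', h⟩
    obtain ⟨τ, hτ, hτp, hτt⟩ := Triples.exists_continuous hn h.symm
    exact ⟨τ ⁻¹' U, fun s hs => ⟨τ s, hs, hτp s⟩, hU.preimage hτ, by rwa [Set.mem_preimage, hτt]⟩
  have h := Triples.isClosed_image_point hn hsat.isClosed_compl (by
    intro t ht t' h
    rw [Set.mem_compl_iff, Set.mem_preimage] at ht ⊢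
    rwa [h])
  rw [← Set.preimage_compl, Set.image_preimage_eq _ (Triples.point_surjective n)] at h
  exact isClosed_compl_iff.1 h

end OpenMap

/-! ### Forms vanishing at a point, and singular points on a line -/

section Points

variable {k : Type*} [Field k]

lemma mul_eq_mul_of_cross_eq_zero {a b : Fin 3 → k} (h : crossProduct a b = 0) (i j : Fin 3) :
    a i * b j = a j * b i := by
  have h0 := congrFun h 0
  have h1 := congrFun h 1
  have h2 := congrFun h 2
  simp [cross_apply] at h0 h1 h2
  fin_cases i <;> fin_cases j <;> simp <;> grind

lemma cross_cross_eq_zero {a v w : Fin 3 → k} (hv : v ⬝ᵥ a = 0) (hw : w ⬝ᵥ a = 0) :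
    crossProduct a (crossProduct v w) = 0 := by
  simp only [dotProduct, Fin.sum_univ_three] at hv hw
  ext i
  fin_cases i <;> simp [cross_apply]
  · linear_combination v 0 * hw - w 0 * hv
  · linear_combination v 1 * hw - w 1 * hv
  · linear_combination v 2 * hw - w 2 * hv

lemma exists_ne_zero_dotProduct_eq_zero (v w : Fin 3 → k) :
    ∃ u : Fin 3 → k, u ≠ 0 ∧ v ⬝ᵥ u = 0 ∧ w ⬝ᵥ u = 0 := by
  obtain ⟨u, hu, h⟩ := Matrix.exists_mulVec_eq_zero_iff.2
    (show (Matrix.of ![v, w, 0]).det = 0 by simp [Matrix.det_fin_three])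
  exact ⟨u, hu, congrFun h 0, congrFun h 1⟩

/-- The gradient of a polynomial at a point. -/
noncomputable def grad (f : MvPolynomial (Fin 3) k) (u : Fin 3 → k) : Fin 3 → k :=
  fun j => eval u (pderiv j f)

lemma isSingularAt_iff {g f : MvPolynomial (Fin 3) k} {u : Fin 3 → k} :
    IsSingularAt g f u ↔ eval u g = 0 ∧ eval u f = 0 ∧
      crossProduct (grad g u) (grad f u) = 0 := by
  refine and_congr_right fun _ => and_congr_right fun _ => ?_
  have h : ∀ i : Fin 3, ((jacobian g f u).submatrix id i.succAbove).det =
      grad g u (i.succAbove 0) * grad f u (i.succAbove 1) -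
        grad g u (i.succAbove 1) * grad f u (i.succAbove 0) := by
    intro i
    rw [Matrix.det_fin_two]
    rfl
  simp only [h, Fin.forall_fin_succ, funext_iff, cross_apply]
  simp [Fin.succAbove]
  grind

lemma grad_linear (l : Form k 1) (u : Fin 3 → k) :
    grad (l : MvPolynomial (Fin 3) k) u = coeffs l := by
  ext i
  simp [grad]

lemma grad_mul (f g : MvPolynomial (Fin 3) k) (u : Fin 3 → k) :
    grad (f * g) u = eval u f • grad g u + eval u g • grad f u := by
  ext i
  simp [grad, Derivation.leibniz]

lemma grad_add (f g : MvPolynomial (Fin 3) k) (u : Fin 3 → k) :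
    grad (f + g) u = grad f u + grad g u := by
  ext i
  simp [grad]

lemma exists_eq_linear_combination {l m r : Form k 1}
    (h : coeffs r ⬝ᵥ crossProduct (coeffs l) (coeffs m) ≠ 0) (a : Form k 1) :
    ∃ x y z : k, a = x • l + y • m + z • r := by
  rw [triple_product_eq_det] at h
  set M : Matrix (Fin 3) (Fin 3) k := ![coeffs r, coeffs l, coeffs m]
  have hM : IsUnit M.det := isUnit_iff_ne_zero.2 h
  have h2 : (coeffs a ᵥ* M⁻¹) ᵥ* M = coeffs a := by
    rw [Matrix.vecMul_vecMul, Matrix.nonsing_inv_mul _ hM, Matrix.vecMul_one]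
  set c := coeffs a ᵥ* M⁻¹
  -- The rows of `M` are `r`, `l`, `m` in this order.
  refine ⟨c 1, c 2, c 0, coeffs_injective ?_⟩
  rw [← h2]
  ext j
  simp [Matrix.vecMul, dotProduct, Fin.sum_univ_three, M]
  ring

/-- The decomposition of the forms with respect to a basis `l, m, r` of the linear forms. -/
lemma exists_eq_add_pow {l m r : Form k 1}
    (hr : coeffs r ⬝ᵥ crossProduct (coeffs l) (coeffs m) ≠ 0) (d : ℕ) (G : Form k (d + 1)) :
    ∃ (h g : Form k d) (c : k), G.1 = l.1 * h.1 + m.1 * g.1 + C c * r.1 ^ (d + 1) := by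
  induction d with
  | zero =>
    obtain ⟨x, y, z, e⟩ := exists_eq_linear_combination hr G
    refine ⟨⟨C x, isHomogeneous_C _ _⟩, ⟨C y, isHomogeneous_C _ _⟩, z, ?_⟩
    rw [e]
    simp [smul_eq_C_mul]
    ring
  | succ d ih =>
    rw [G.1.as_sum]
    refine Finset.sum_induction _ (fun F => ∃ (h g : Form k (d + 1)) (c : k),
      F = l.1 * h.1 + m.1 * g.1 + C c * r.1 ^ (d + 1 + 1)) ?_ ⟨0, 0, 0, by simp⟩ ?_
    · rintro _ _ ⟨h, g, c, rfl⟩ ⟨h', g', c', rfl⟩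
      refine ⟨h + h', g + g', c + c', ?_⟩
      simp only [Submodule.coe_add, C_add]
      ring
    intro ν hν
    have hdeg : ν.degree = d + 1 + 1 := by
      by_contra hne
      exact (mem_support_iff.1 hν) (((mem_homogeneousSubmodule _ _).1 G.2).coeff_eq_zero hne)
    obtain ⟨i, hi⟩ : ∃ i, ν i ≠ 0 := by
      by_contra! hc
      rw [show ν = 0 from Finsupp.ext hc] at hdeg
      simp at hdeg
    have hν' : Finsupp.single i 1 + (ν - Finsupp.single i 1) = ν :=
      add_tsub_cancel_of_le (Finsupp.single_le_iff.2 (Nat.one_le_iff_ne_zero.2 hi))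
    set ν' := ν - Finsupp.single i 1
    set a := G.1.coeff ν
    have hd' : ν'.degree = d + 1 := by
      rw [← hν', map_add, Finsupp.degree_single] at hdeg
      omega
    let G' : Form k (d + 1) := ⟨monomial ν' a, isHomogeneous_monomial _ hd'⟩
    have e1 : monomial ν a = X i * G'.1 := by
      rw [← hν', X, monomial_mul, one_mul]
    -- In `X i * G'` with `X i = x l + y m + z r`, only the term `z r G'` is not yet in the ideal
    -- `(l, m)`; the induction hypothesis is applied to the factor `G'` there.
    obtain ⟨x, y, z, e2⟩ := exists_eq_linear_combination hr ⟨X i, isHomogeneous_X _ _⟩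
    have e3 : (X i : MvPolynomial (Fin 3) k) = C x * l.1 + C y * m.1 + C z * r.1 := by
      have := congrArg Subtype.val e2
      simpa [smul_eq_C_mul] using this
    obtain ⟨h, g, c, e4⟩ := ih G'
    have hmem : ∀ (x z : k) (h : Form k d), C x * G'.1 + C z * (r.1 * h.1) ∈ Form k (d + 1) := by
      intro x z h
      have h1 : r.1 * h.1 ∈ Form k (d + 1) := by
        rw [add_comm d 1]
        exact IsHomogeneous.mul r.2 h.2
      rw [← smul_eq_C_mul, ← smul_eq_C_mul]
      exact Submodule.add_mem _ (Submodule.smul_mem _ _ G'.2) (Submodule.smul_mem _ _ h1)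
    refine ⟨⟨_, hmem x z h⟩, ⟨_, hmem y z g⟩, z * c, ?_⟩
    rw [e1, e3]
    dsimp only
    rw [C_mul]
    linear_combination C z * r.1 * e4

/-- A form which vanishes at the intersection point of two lines `l = 0` and `m = 0` belongs to the
ideal `(l, m)`. -/
lemma exists_eq_add_of_eval_eq_zero {l m : Form k 1} (hlm : LinearIndependent k ![l, m])
    {u : Fin 3 → k} (hu : u ≠ 0) (hl : eval u l.1 = 0) (hm : eval u m.1 = 0) {d : ℕ}
    (G : Form k (d + 1)) (hG : eval u G.1 = 0) :
    ∃ h g : Form k d, G.1 = l.1 * h.1 + m.1 * g.1 := by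
  obtain ⟨i, hi⟩ := Function.ne_iff.1 hu
  rw [eval_eq_dotProduct] at hl hm
  have hcr := mul_eq_mul_of_cross_eq_zero (cross_cross_eq_zero hl hm)
  have hne := (linearIndependent_iff_cross l m).1 hlm
  -- The third basis vector is a coordinate that does not vanish at `u`. It completes `l, m` to a
  -- basis because `l × m` is parallel to `u`, and evaluation at `u` then kills the coefficient of
  -- its power.
  have hr : coeffs (ofCoeffs (Pi.single i 1)) ⬝ᵥ crossProduct (coeffs l) (coeffs m) ≠ 0 := by
    rw [coeffs_ofCoeffs, single_dotProduct, one_mul]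
    intro h0
    refine hne (funext fun j => ?_)
    have := hcr i j
    rw [h0, mul_zero] at this
    exact (mul_eq_zero.1 this).resolve_left hi
  obtain ⟨h, g, c, e⟩ := exists_eq_add_pow hr d G
  refine ⟨h, g, ?_⟩
  have h1 := congrArg (eval u) e
  rw [hG, map_add, map_add, map_mul, map_mul, map_mul, map_pow, eval_C, eval_eq_dotProduct l,
    eval_eq_dotProduct m, hl, hm, eval_eq_dotProduct, coeffs_ofCoeffs, single_dotProduct, one_mul,
    zero_mul, zero_mul, zero_add, zero_add] at h1
  have hc : c = 0 := (mul_eq_zero.1 h1.symm).resolve_right (pow_ne_zero _ hi)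
  rw [e, hc, C_0, zero_mul, add_zero]

/-- A form of degree at least `2` has a singular zero on a line `l = 0` if and only if its
restriction to the line is divisible by the square of a linear form. -/
lemma isSingularPair_linear_iff {l : Form k 1} (hl : l ≠ 0) {d : ℕ} (f : Form k (d + 2)) :
    IsSingularPair l.1 f.1 ↔ ∃ (m : Form k 1) (g : Form k d) (h : Form k (d + 1)),
      f.1 = m.1 ^ 2 * g.1 + l.1 * h.1 := by
  constructor
  · rintro ⟨u, hu, h⟩
    obtain ⟨hlu, hfu, hcr⟩ := isSingularAt_iff.1 h
    obtain ⟨j, hj⟩ : ∃ j, coeffs l j ≠ 0 := by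
      by_contra! hc
      exact hl (coeffs_injective (by rw [map_zero]; exact funext hc))
    -- A second line through `u`, distinct from `l = 0`: as `l · u = 0`, the triple product `l × (u
    -- × eⱼ)` equals `lⱼ u`.
    set m : Form k 1 := ofCoeffs (crossProduct u (Pi.single j 1))
    have hmu : eval u m.1 = 0 := by
      rw [eval_eq_dotProduct, coeffs_ofCoeffs, dotProduct_comm, dot_self_cross]
    have hlm : LinearIndependent k ![l, m] := by
      rw [linearIndependent_iff_cross, coeffs_ofCoeffs]
      intro h0
      refine hu (funext fun i => ?_)
      have e : crossProduct (coeffs l) (crossProduct u (Pi.single j 1)) i = coeffs l j * u i := by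
        have h3 := hlu
        rw [eval_eq_dotProduct] at h3
        simp only [dotProduct, Fin.sum_univ_three] at h3
        fin_cases j <;> fin_cases i <;> simp [cross_apply] <;> linear_combination -h3
      rw [h0] at e
      exact (mul_eq_zero.1 e.symm).resolve_left hj
    obtain ⟨h₁, g₁, e⟩ := exists_eq_add_of_eval_eq_zero hlm hu hlu hmu f hfu
    -- The gradient of `l h₁ + m g₁` at `u` is `h₁(u) l + g₁(u) m`, and it is parallel to `l`. So
    -- `g₁` vanishes at `u` and can be decomposed in turn.
    have hg₁ : eval u g₁.1 = 0 := by
      rw [e, grad_add, grad_mul, grad_mul, hlu, hmu, grad_linear, grad_linear] at hcr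
      simp only [zero_smul, zero_add, map_add, map_smul, cross_self, smul_zero] at hcr
      exact (smul_eq_zero.1 hcr).resolve_right ((linearIndependent_iff_cross _ _).1 hlm)
    obtain ⟨h₂, g₂, e'⟩ := exists_eq_add_of_eval_eq_zero hlm hu hlu hmu g₁ hg₁
    have hmem : m.1 * h₂.1 ∈ Form k (d + 1) := by
      rw [add_comm d 1]
      exact IsHomogeneous.mul m.2 h₂.2
    refine ⟨m, g₂, h₁ + ⟨_, hmem⟩, ?_⟩
    rw [e, e', Submodule.coe_add]
    ring
  · rintro ⟨m, g, h, e⟩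
    obtain ⟨u, hu, hl0, hm0⟩ := exists_ne_zero_dotProduct_eq_zero (coeffs l) (coeffs m)
    rw [← eval_eq_dotProduct] at hl0 hm0
    refine ⟨u, hu, isSingularAt_iff.2 ⟨hl0, ?_, ?_⟩⟩
    · rw [e]
      simp [hl0, hm0]
    · rw [e, pow_two, grad_add, grad_mul, grad_mul, grad_mul, grad_linear, hl0]
      simp [hm0]

lemma eval_cross_eq_zero_iff {l m : Form k 1} (hlm : LinearIndependent k ![l, m]) {d : ℕ}
    (f : Form k (d + 1)) : eval (crossProduct (coeffs l) (coeffs m)) f.1 = 0 ↔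
      ∃ h g : Form k d, f.1 = l.1 * h.1 + m.1 * g.1 := by
  have hl : eval (crossProduct (coeffs l) (coeffs m)) l.1 = 0 := by
    rw [eval_eq_dotProduct, dot_self_cross]
  have hm : eval (crossProduct (coeffs l) (coeffs m)) m.1 = 0 := by
    rw [eval_eq_dotProduct, dot_cross_self]
  refine ⟨exists_eq_add_of_eval_eq_zero hlm ((linearIndependent_iff_cross _ _).1 hlm) hl hm f, ?_⟩
  rintro ⟨h, g, e⟩
  rw [e]
  simp [hl, hm]

/-- The singular points of the intersection with a pair of lines. -/
lemma isSingularPair_mul_iff {l m : Form k 1} (f : MvPolynomial (Fin 3) k) :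
    IsSingularPair (l.1 * m.1) f ↔
      (∃ u : Fin 3 → k, u ≠ 0 ∧ eval u l.1 = 0 ∧ eval u m.1 = 0 ∧ eval u f = 0) ∨
        IsSingularPair l.1 f ∨ IsSingularPair m.1 f := by
  -- At the node this gradient is zero and the rank condition is automatic; elsewhere on `l = 0` it
  -- is a nonzero multiple of that of `l`.
  have key : ∀ (l m : Form k 1) (u : Fin 3 → k), eval u l.1 = 0 →
      grad (l.1 * m.1) u = eval u m.1 • coeffs l := by
    intro l m u h
    rw [grad_mul, h, zero_smul, zero_add, grad_linear]
  constructor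
  · rintro ⟨u, hu, h⟩
    obtain ⟨h1, h2, h3⟩ := isSingularAt_iff.1 h
    rw [map_mul, mul_eq_zero] at h1
    have main : ∀ l m : Form k 1, eval u l.1 = 0 → eval u m.1 ≠ 0 →
        crossProduct (grad (l.1 * m.1) u) (grad f u) = 0 → IsSingularPair l.1 f := by
      intro l m hl hm h
      refine ⟨u, hu, isSingularAt_iff.2 ⟨hl, h2, ?_⟩⟩
      rw [key l m u hl, map_smul, LinearMap.smul_apply] at h
      rw [grad_linear]
      exact (smul_eq_zero.1 h).resolve_left hm
    by_cases hl : eval u l.1 = 0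
    · by_cases hm : eval u m.1 = 0
      · exact Or.inl ⟨u, hu, hl, hm, h2⟩
      · exact Or.inr (Or.inl (main l m hl hm h3))
    · rw [mul_comm l.1] at h3
      exact Or.inr (Or.inr (main m l (h1.resolve_left hl) hl h3))
  · have main : ∀ l m : Form k 1, IsSingularPair l.1 f → IsSingularPair (l.1 * m.1) f := by
      rintro l m ⟨u, hu, h⟩
      obtain ⟨h1, h2, h3⟩ := isSingularAt_iff.1 h
      rw [grad_linear] at h3
      refine ⟨u, hu, isSingularAt_iff.2 ⟨by rw [map_mul, h1, zero_mul], h2, ?_⟩⟩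
      rw [key l m u h1, map_smul, LinearMap.smul_apply, h3, smul_zero]
    rintro (⟨u, hu, hl, hm, hf⟩ | h | h)
    · refine ⟨u, hu, isSingularAt_iff.2 ⟨by rw [map_mul, hl, zero_mul], hf, ?_⟩⟩
      rw [key l m u hl, hm, zero_smul, map_zero, LinearMap.zero_apply]
    · exact main l m h
    · rw [mul_comm]
      exact main m l h

end Points

/-! ### The loci `D_nod`, `D¹_nod` and `D²_nod` in terms of triples -/

section Loci

variable {k : Type*} [Field k]

/-- On the common zeros, adding `e g` to `f` only adds a multiple of the gradient of `g`. This makes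
singularity independent of the representative of `[f]`. -/
lemma IsSingularPair.smul_add {g f : MvPolynomial (Fin 3) k} (h : IsSingularPair g f) (c a : k)
    (e : MvPolynomial (Fin 3) k) : IsSingularPair (C c * g) (C a * f + e * g) := by
  obtain ⟨u, hu, h⟩ := h
  obtain ⟨h1, h2, h3⟩ := isSingularAt_iff.1 h
  have hC : ∀ a : k, grad (C a) u = 0 := fun a => by
    ext i
    simp [grad]
  refine ⟨u, hu, isSingularAt_iff.2 ⟨by simp [h1], by simp [h1, h2], ?_⟩⟩
  simp [grad_add, grad_mul, hC, h1, h2, h3]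

lemma exists_pair_eq {n : ℕ} {t : Triples k n} {p : Pairs k n} (h : proj p = t.point.1) :
    p.1.1 = prodForm t.1.1 t.1.2.1 ∧ ∃ (c : k) (e : MvPolynomial (Fin 3) k), c ≠ 0 ∧
      t.1.2.2.1 = C c * p.1.2.1 + e * (t.1.1.1 * t.1.2.1.1) := by
  obtain ⟨hq, c, hc, hm⟩ := (proj_eq_iff (p' := t.pair)).1 h
  obtain ⟨g, hg⟩ := mem_multiples.1 hm
  refine ⟨hq, c, g.1, hc, ?_⟩
  have hg' : g.1 * p.1.1.1 = t.1.2.2.1 - c • p.1.2.1 := hg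
  have hq' : p.1.1.1 = t.1.1.1 * t.1.2.1.1 := congrArg Subtype.val hq
  rw [← hq', hg', smul_eq_C_mul]
  ring

lemma Triples.point_mem_Dnod_iff {n : ℕ} (t : Triples k n) :
    t.point ∈ Dnod k n ↔ IsSingularPair (t.1.1.1 * t.1.2.1.1) t.1.2.2.1 := by
  constructor
  · rintro ⟨p, hp, hpt⟩
    obtain ⟨hq, c, e, hc, hf⟩ := exists_pair_eq hpt
    have h := IsSingularPair.smul_add hp 1 c e
    rw [hq, C_1, one_mul] at h
    rw [hf]
    exact h
  · intro h
    exact ⟨t.pair, h, rfl⟩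

lemma Triples.point_mem_D1nod_iff {n : ℕ} (t : Triples k n) :
    t.point ∈ D1nod k n ↔ ∃ u : Fin 3 → k, u ≠ 0 ∧ eval u t.1.1.1 = 0 ∧ eval u t.1.2.1.1 = 0 ∧
      eval u t.1.2.2.1 = 0 := by
  constructor
  · rintro ⟨p, hpt, l₁, l₂, hl, u, hu, h1, h2, h3⟩
    obtain ⟨hq, c, e, hc, hf⟩ := exists_pair_eq hpt
    have hl' : prodForm t.1.1 t.1.2.1 = prodForm l₁ l₂ := hq.symm.trans (Subtype.ext hl)
    obtain ⟨hn1, hn2⟩ := LinearIndependent.pair_ne_zero (linearIndependent_of_prodForm_eq t.2.1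
      hl'.symm)
    have key : eval u t.1.1.1 = 0 ∧ eval u t.1.2.1.1 = 0 := by
      obtain ⟨c, hc, ⟨e1, e2⟩ | ⟨e1, e2⟩⟩ := factorization_unique hn1 hn2 hl' <;>
      · rw [e1, e2]
        simp [smul_eval, h1, h2]
    refine ⟨u, hu, key.1, key.2, ?_⟩
    rw [hf]
    simp [h3, key.1]
  · rintro ⟨u, hu, h⟩
    exact ⟨t.pair, rfl, t.1.1, t.1.2.1, rfl, u, hu, h⟩

lemma Triples.point_mem_D2nod_iff {n : ℕ} (t : Triples k n) :
    t.point ∈ D2nod k n ↔ IsSingularPair t.1.1.1 t.1.2.2.1 ∨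
      IsSingularPair t.1.2.1.1 t.1.2.2.1 := by
  constructor
  · rintro ⟨p, hpt, l₁, l₂, hl, h⟩
    obtain ⟨hq, c, e, hc, hf⟩ := exists_pair_eq hpt
    have hl' : prodForm t.1.1 t.1.2.1 = prodForm l₁ l₂ := hq.symm.trans (Subtype.ext hl)
    obtain ⟨hn1, hn2⟩ := LinearIndependent.pair_ne_zero (linearIndependent_of_prodForm_eq t.2.1
      hl'.symm)
    have hll : t.1.1.1 * t.1.2.1.1 = l₁.1 * l₂.1 := congrArg Subtype.val hl'
    have key : ∀ (l : Form k 1) (b : k), IsSingularPair l.1 p.1.2.1 →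
        (∃ e', l₁.1 * l₂.1 = e' * l.1) → IsSingularPair (b • l).1 t.1.2.2.1 := by
      rintro l b h ⟨e', he'⟩
      have h2 := h.smul_add b c (e * e')
      rw [mul_assoc, ← he', ← hll, ← hf, ← smul_eq_C_mul] at h2
      exact h2
    have k1 := fun (h : IsSingularPair l₁.1 p.1.2.1) b => key l₁ b h ⟨l₂.1, mul_comm _ _⟩
    have k2 := fun (h : IsSingularPair l₂.1 p.1.2.1) b => key l₂ b h ⟨l₁.1, rfl⟩
    obtain ⟨c, hc, ⟨e1, e2⟩ | ⟨e1, e2⟩⟩ := factorization_unique hn1 hn2 hl'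
    · rw [e1, e2]
      exact h.imp (k1 · _) (k2 · _)
    · rw [e1, e2]
      exact h.symm.imp (k2 · _) (k1 · _)
  · rintro h
    exact ⟨t.pair, rfl, t.1.1, t.1.2.1, rfl, h⟩

lemma Dnod_eq_union (n : ℕ) : Dnod k n = D1nod k n ∪ D2nod k n := by
  ext x
  obtain ⟨t, rfl⟩ := Triples.point_surjective n x
  rw [Set.mem_union, t.point_mem_Dnod_iff, t.point_mem_D1nod_iff, t.point_mem_D2nod_iff]
  exact isSingularPair_mul_iff _

/-- The triples `(l₁, l₂, f)` such that `f` belongs to the ideal `(l₁, l₂)`. -/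
def nodeLocus (k : Type*) [Field k] (d : ℕ) : Set (Aff k (TripleSpace k (d + 2))) :=
  {t : TripleSpace k (d + 2) | ∃ h g : Form k (d + 1), t.2.2.1 = t.1.1 * h.1 + t.2.1.1 * g.1}

/-- The triples `(l₁, l₂, f)` such that `f` is, modulo `l₁`, divisible by the square of a linear
form. -/
def tangentLocus (k : Type*) [Field k] (d : ℕ) : Set (Aff k (TripleSpace k (d + 2))) :=
  {t : TripleSpace k (d + 2) | ∃ (m : Form k 1) (g : Form k d) (h : Form k (d + 1)),
    t.2.2.1 = m.1 ^ 2 * g.1 + t.1.1 * h.1}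

lemma Triples.val_mem_nodeLocus_iff {d : ℕ} (t : Triples k (d + 2)) :
    t.val ∈ nodeLocus k d ↔ eval (crossProduct (coeffs t.1.1) (coeffs t.1.2.1)) t.1.2.2.1 = 0 :=
  (eval_cross_eq_zero_iff t.2.1 t.1.2.2).symm

lemma Triples.val_mem_tangentLocus_iff {d : ℕ} (t : Triples k (d + 2)) :
    t.val ∈ tangentLocus k d ↔ IsSingularPair t.1.1.1 t.1.2.2.1 :=
  (isSingularPair_linear_iff (LinearIndependent.pair_ne_zero t.2.1).1 t.1.2.2).symm

lemma Triples.point_mem_D1nod_iff' {d : ℕ} (t : Triples k (d + 2)) :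
    t.point ∈ D1nod k (d + 2) ↔ t.val ∈ nodeLocus k d := by
  rw [t.point_mem_D1nod_iff]
  constructor
  · rintro ⟨u, hu, h1, h2, h3⟩
    exact exists_eq_add_of_eval_eq_zero t.2.1 hu h1 h2 t.1.2.2 h3
  · intro h
    rw [t.val_mem_nodeLocus_iff] at h
    refine ⟨_, (linearIndependent_iff_cross _ _).1 t.2.1, ?_, ?_, h⟩
    · rw [eval_eq_dotProduct, dot_self_cross]
    · rw [eval_eq_dotProduct, dot_cross_self]

lemma D1nod_eq_image (d : ℕ) :
    D1nod k (d + 2) = Triples.point '' (Triples.val ⁻¹' nodeLocus k d) := by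
  ext x
  constructor
  · intro h
    obtain ⟨t, rfl⟩ := Triples.point_surjective _ x
    exact ⟨t, t.point_mem_D1nod_iff'.1 h, rfl⟩
  · rintro ⟨t, ht, rfl⟩
    exact t.point_mem_D1nod_iff'.2 ht

/-- The exchange of the two lines allows the singular one to be the first. This is why `D2nod` is
irreducible although its preimage is a union of two loci, one for each line. -/
lemma D2nod_eq_image (d : ℕ) :
    D2nod k (d + 2) = Triples.point '' (Triples.val ⁻¹' tangentLocus k d) := by
  ext x
  constructor
  · intro h
    obtain ⟨t, rfl⟩ := Triples.point_surjective _ x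
    rcases t.point_mem_D2nod_iff.1 h with h | h
    · exact ⟨t, t.val_mem_tangentLocus_iff.2 h, rfl⟩
    · exact ⟨t.swap, t.swap.val_mem_tangentLocus_iff.2 h, t.point_swap⟩
  · rintro ⟨t, ht, rfl⟩
    exact t.point_mem_D2nod_iff.2 (Or.inl (t.val_mem_tangentLocus_iff.1 ht))

/-! ### Irreducibility -/

lemma isIrreducible_range {E F : Type*} [Infinite k] [AddCommGroup E] [Module k E]
    [AddCommGroup F] [Module k F] {u : E → F} (hu : IsPolyMap (k := k) u) :
    IsIrreducible (X := Aff k F) (Set.range u) := by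
  have := IsIrreducible.image (X := Aff k E) (Y := Aff k F)
    (IrreducibleSpace.isIrreducible_univ (Aff k E)) u hu.continuous.continuousOn
  exact Set.image_univ (f := u) ▸ this

lemma mul_mem_form {a b c : ℕ} (h : a + b = c) (f : Form k a) (g : Form k b) :
    f.1 * g.1 ∈ Form k c :=
  h ▸ IsHomogeneous.mul f.2 g.2

lemma isIrreducible_nodeLocus [Infinite k] (d : ℕ) : IsIrreducible (nodeLocus k d) := by
  let E := Form k 1 × Form k 1 × Form k (d + 1) × Form k (d + 1)
  let L : E →ₗ[k] Form k 1 := LinearMap.fst k _ _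
  let M : E →ₗ[k] Form k 1 := LinearMap.fst k _ _ ∘ₗ LinearMap.snd k _ _
  let H : E →ₗ[k] Form k (d + 1) :=
    LinearMap.fst k _ _ ∘ₗ LinearMap.snd k _ _ ∘ₗ LinearMap.snd k _ _
  let G : E →ₗ[k] Form k (d + 1) :=
    LinearMap.snd k _ _ ∘ₗ LinearMap.snd k _ _ ∘ₗ LinearMap.snd k _ _
  let F : E → Form k (d + 2) := fun x => ⟨(L x).1 * (H x).1 + (M x).1 * (G x).1,
    Submodule.add_mem _ (mul_mem_form (by omega) _ _) (mul_mem_form (by omega) _ _)⟩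
  have hF : IsPolyMap (k := k) F := IsPolyFam.isPolyMap
    (((IsPolyFam.of_linear L).mul (IsPolyFam.of_linear H)).add
      ((IsPolyFam.of_linear M).mul (IsPolyFam.of_linear G)))
  convert isIrreducible_range ((IsPolyMap.of_linear L).prodMk ((IsPolyMap.of_linear M).prodMk hF))
    using 1
  refine Set.ext fun (t : TripleSpace k (d + 2)) => ⟨?_, ?_⟩
  · rintro ⟨h, g, e⟩
    exact ⟨(t.1, t.2.1, h, g), Prod.ext rfl (Prod.ext rfl (Subtype.ext e.symm))⟩
  · rintro ⟨x, rfl⟩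
    exact ⟨H x, G x, rfl⟩

lemma isIrreducible_tangentLocus [Infinite k] (d : ℕ) : IsIrreducible (tangentLocus k d) := by
  let E := Form k 1 × Form k 1 × Form k 1 × Form k d × Form k (d + 1)
  let L : E →ₗ[k] Form k 1 := LinearMap.fst k _ _
  let L' : E →ₗ[k] Form k 1 := LinearMap.fst k _ _ ∘ₗ LinearMap.snd k _ _
  let M : E →ₗ[k] Form k 1 := LinearMap.fst k _ _ ∘ₗ LinearMap.snd k _ _ ∘ₗ LinearMap.snd k _ _
  let G : E →ₗ[k] Form k d := LinearMap.fst k _ _ ∘ₗ LinearMap.snd k _ _ ∘ₗ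
    LinearMap.snd k _ _ ∘ₗ LinearMap.snd k _ _
  let H : E →ₗ[k] Form k (d + 1) := LinearMap.snd k _ _ ∘ₗ LinearMap.snd k _ _ ∘ₗ
    LinearMap.snd k _ _ ∘ₗ LinearMap.snd k _ _
  let F : E → Form k (d + 2) := fun x => ⟨(M x).1 * (M x).1 * (G x).1 + (L x).1 * (H x).1,
    Submodule.add_mem _ (mul_mem_form (by omega) (prodForm (M x) (M x)) _)
      (mul_mem_form (by omega) _ _)⟩
  have hF : IsPolyMap (k := k) F := IsPolyFam.isPolyMap
    ((((IsPolyFam.of_linear M).mul (IsPolyFam.of_linear M)).mul (IsPolyFam.of_linear G)).add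
      ((IsPolyFam.of_linear L).mul (IsPolyFam.of_linear H)))
  convert isIrreducible_range ((IsPolyMap.of_linear L).prodMk ((IsPolyMap.of_linear L').prodMk hF))
    using 1
  refine Set.ext fun (t : TripleSpace k (d + 2)) => ⟨?_, ?_⟩
  · rintro ⟨m, g, h, e⟩
    refine ⟨(t.1, t.2.1, m, g, h), Prod.ext rfl (Prod.ext rfl (Subtype.ext ?_))⟩
    exact (e.trans (by rw [pow_two]; rfl)).symm
  · rintro ⟨x, rfl⟩
    refine ⟨M x, G x, H x, ?_⟩
    rw [pow_two]

/-! ### Closedness -/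

lemma isSingularAt_smul {a b : ℕ} {g : Form k a} {f : Form k b} {u : Fin 3 → k}
    (h : IsSingularAt g.1 f.1 u) (c : k) : IsSingularAt g.1 f.1 (c • u) := by
  have key : ∀ {a : ℕ} (g : Form k a), grad g.1 (c • u) = c ^ (a - 1) • grad g.1 u := by
    intro a g
    ext i
    exact eval_smul_of_isHomogeneous (IsHomogeneous.pderiv g.2) c u
  obtain ⟨h1, h2, h3⟩ := isSingularAt_iff.1 h
  refine isSingularAt_iff.2 ⟨?_, ?_, ?_⟩
  · rw [eval_smul_of_isHomogeneous g.2, h1, mul_zero]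
  · rw [eval_smul_of_isHomogeneous f.2, h2, mul_zero]
  · rw [key, key]
    simp [h3]

variable [IsAlgClosed k]

lemma Triples.isClosed_iff_preimage_point {n : ℕ} (hn : 2 ≤ n) {S : Set (PVnod k n)} :
    IsClosed (Triples.point ⁻¹' S) ↔ IsClosed S :=
  (IsOpenQuotientMap.mk (Triples.point_surjective n) (Triples.continuous_point n)
    (Triples.isOpenMap_point hn)).isQuotientMap.isClosed_preimage

lemma isClosed_D1nod (d : ℕ) : IsClosed (D1nod k (d + 2)) := by
  rw [← Triples.isClosed_iff_preimage_point (by omega)]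
  have h := (IsPolyFam.eval (IsPolyFam.of_linear (trdForm (k := k) (d + 2)))
    (isPolyFun_cross (fstForm (d + 2)) (sndForm (d + 2)))).isClosed
  convert h.preimage (Triples.continuous_val (d + 2)) using 1
  ext t
  exact t.point_mem_D1nod_iff'.trans t.val_mem_nodeLocus_iff

/-- The set of the pairs of forms with a singular common zero is closed. -/
lemma isClosed_isSingularPair (a b : ℕ) :
    IsClosed (X := Aff k (Form k a × Form k b))
      {x : Form k a × Form k b | IsSingularPair x.1.1 x.2.1} := by
  let E := (Form k a × Form k b) × (Fin 3 → k)
  let G : E →ₗ[k] Form k a := LinearMap.fst k _ _ ∘ₗ LinearMap.fst k _ _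
  let F : E →ₗ[k] Form k b := LinearMap.snd k _ _ ∘ₗ LinearMap.fst k _ _
  have hu : ∀ i, IsPolyFun fun x : E => x.2 i := fun i =>
    IsPolyFun.linear ((LinearMap.proj i : (Fin 3 → k) →ₗ[k] k) ∘ₗ
      LinearMap.snd k (Form k a × Form k b) (Fin 3 → k))
  have hG := IsPolyFam.of_linear G
  have hF := IsPolyFam.of_linear F
  have h := ((hG.eval hu).isClosed.inter (hF.eval hu).isClosed).inter
    (isClosed_of_forall_isPolyFun (IsPolyFun.cross (a := fun x : E => grad (G x).1 x.2)
      (b := fun x : E => grad (F x).1 x.2) (fun i => (hG.pderiv i).eval hu)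
      (fun i => (hF.pderiv i).eval hu)))
  have hset : ∀ (x : Form k a × Form k b) (u : Fin 3 → k), IsSingularAt x.1.1 x.2.1 u ↔
      ((x, u) : E) ∈ ({x : E | eval x.2 (G x).1 = 0} ∩ {x : E | eval x.2 (F x).1 = 0}) ∩
        {x : E | ∀ i, crossProduct (grad (G x).1 x.2) (grad (F x).1 x.2) i = 0} := by
    intro x u
    rw [isSingularAt_iff, ← and_assoc]
    exact and_congr Iff.rfl funext_iff
  have := isClosed_elimination h fun x u hxu c _ =>
    (hset x _).1 (isSingularAt_smul ((hset x u).2 hxu) c)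
  convert this using 1
  exact Set.ext fun x => exists_congr fun u => and_congr Iff.rfl (hset x u)

lemma isClosed_D2nod {n : ℕ} (hn : 2 ≤ n) : IsClosed (D2nod k n) := by
  rw [← Triples.isClosed_iff_preimage_point hn]
  have h := isClosed_isSingularPair (k := k) 1 n
  have h1 := h.preimage
    ((IsPolyMap.of_linear (fstForm n)).prodMk (IsPolyMap.of_linear (trdForm n))).continuous
  have h2 := h.preimage
    ((IsPolyMap.of_linear (sndForm n)).prodMk (IsPolyMap.of_linear (trdForm n))).continuous
  convert (h1.union h2).preimage (Triples.continuous_val n) using 1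
  ext t
  exact t.point_mem_D2nod_iff

end Loci

/-! ### The discriminant of the restriction to a line -/

section Discriminant

variable {A : Type*} [CommRing A]

/-- A parametrization, on an affine chart, of the line with given coefficients. -/
noncomputable def linePoint (v : Fin 3 → A) : Fin 3 → Polynomial A :=
  ![Polynomial.C (v 2), Polynomial.C (v 2) * Polynomial.X,
    -(Polynomial.C (v 0) + Polynomial.C (v 1) * Polynomial.X)]

/-- The restriction of a polynomial to the line with coefficients `v`. -/
noncomputable def linePoly (v : Fin 3 → A) (F : MvPolynomial (Fin 3) A) : Polynomial A :=
  eval₂ Polynomial.C (linePoint v) F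

lemma map_linePoly {B : Type*} [CommRing B] (φ : A →+* B) (v : Fin 3 → A)
    (F : MvPolynomial (Fin 3) A) :
    (linePoly v F).map φ = linePoly (fun i => φ (v i)) (map φ F) := by
  have h : (Polynomial.mapRingHom φ) ∘ linePoint v = linePoint fun i => φ (v i) := by
    ext1 i
    fin_cases i <;> simp [linePoint]
  have := eval₂_comp_left (Polynomial.mapRingHom φ) Polynomial.C (linePoint v) F
  rw [Polynomial.coe_mapRingHom] at this
  rw [linePoly, this, linePoly, eval₂_map]
  congr 1
  ext a
  simp

lemma eval_linePoly (v : Fin 3 → A) (F : MvPolynomial (Fin 3) A) (t : A) :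
    (linePoly v F).eval t = eval (fun i => (linePoint v i).eval t) F := by
  have := eval₂_comp_left (Polynomial.evalRingHom t) Polynomial.C (linePoint v) F
  rw [Polynomial.coe_evalRingHom] at this
  rw [linePoly, this, MvPolynomial.eval, coe_eval₂Hom]
  congr 1
  ext a
  simp

lemma derivative_linePoly (v : Fin 3 → A) (F : MvPolynomial (Fin 3) A) :
    (linePoly v F).derivative = Polynomial.C (v 2) * linePoly v (pderiv 1 F) -
      Polynomial.C (v 1) * linePoly v (pderiv 2 F) := by
  induction F using MvPolynomial.induction_on with
  | C a => simp [linePoly]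
  | add p q hp hq =>
    simp only [linePoly, map_add, eval₂_add] at hp hq ⊢
    rw [hp, hq]
    ring
  | mul_X p i hp =>
    simp only [linePoly, Derivation.leibniz, smul_eq_mul, eval₂_mul, eval₂_add, eval₂_X,
      Polynomial.derivative_mul, pderiv_X] at hp ⊢
    rw [hp]
    fin_cases i <;> simp [linePoint] <;> ring

lemma natDegree_linePoint_le (v : Fin 3 → A) (i : Fin 3) : (linePoint v i).natDegree ≤ 1 := by
  fin_cases i <;> simp only [linePoint] <;> simp <;> compute_degree

lemma linePoly_monomial (v : Fin 3 → A) (ν : Fin 3 →₀ ℕ) (a : A) :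
    (linePoly v (monomial ν a)).natDegree ≤ ν.degree ∧
      (linePoly v (monomial ν a)).coeff ν.degree =
        eval (fun i => (linePoint v i).coeff 1) (monomial ν a) := by
  have hpow : ∀ i, (linePoint v i ^ ν i).natDegree ≤ ν i := fun i => by
    simpa using Polynomial.natDegree_pow_le_of_le (ν i) (natDegree_linePoint_le v i)
  have hcoeff : ∀ i, (linePoint v i ^ ν i).coeff (ν i) = (linePoint v i).coeff 1 ^ ν i := fun i => by
    simpa using Polynomial.coeff_pow_of_natDegree_le (m := ν i) (natDegree_linePoint_le v i)
  have hp : linePoly v (monomial ν a) =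
      Polynomial.C a * (linePoint v 0 ^ ν 0 * linePoint v 1 ^ ν 1 * linePoint v 2 ^ ν 2) := by
    rw [linePoly, eval₂_monomial, Finsupp.prod_fintype _ _ (by simp), Fin.prod_univ_three]
  have h1 := Polynomial.natDegree_mul_le_of_le (hpow 0) (hpow 1)
  have h2 := Polynomial.natDegree_mul_le_of_le h1 (hpow 2)
  have hd : ν.degree = ν 0 + ν 1 + ν 2 := by
    rw [Finsupp.degree_eq_sum, Fin.sum_univ_three]
  rw [hp, hd]
  refine ⟨(Polynomial.natDegree_C_mul_le _ _).trans h2, ?_⟩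
  rw [Polynomial.coeff_C_mul, Polynomial.coeff_mul_add_eq_of_natDegree_le h1 (hpow 2),
    Polynomial.coeff_mul_add_eq_of_natDegree_le (hpow 0) (hpow 1), hcoeff, hcoeff, hcoeff, eval_monomial,
    Finsupp.prod_fintype _ _ (by simp), Fin.prod_univ_three]

lemma linePoly_sum (v : Fin 3 → A) (F : MvPolynomial (Fin 3) A) :
    linePoly v F = ∑ ν ∈ F.support, linePoly v (monomial ν (F.coeff ν)) := by
  conv_lhs => rw [F.as_sum, linePoly, eval₂_sum]
  rfl

lemma natDegree_linePoly_le (v : Fin 3 → A) {F : MvPolynomial (Fin 3) A} {n : ℕ}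
    (hF : F.IsHomogeneous n) : (linePoly v F).natDegree ≤ n := by
  rw [linePoly_sum]
  refine Polynomial.natDegree_sum_le_of_forall_le _ _ fun ν hν => ?_
  have hdeg : ν.degree = n := by
    by_contra hne
    exact (mem_support_iff.1 hν) (hF.coeff_eq_zero hne)
  exact hdeg ▸ (linePoly_monomial v ν _).1

/-- The top coefficient is the value of the form at the point at infinity of the parametrized line.
-/
lemma coeff_linePoly (v : Fin 3 → A) {F : MvPolynomial (Fin 3) A} {n : ℕ}
    (hF : F.IsHomogeneous n) :
    (linePoly v F).coeff n = eval (fun i => (linePoint v i).coeff 1) F := by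
  rw [linePoly_sum, Polynomial.finsetSum_coeff]
  conv_rhs => rw [F.as_sum, map_sum]
  refine Finset.sum_congr rfl fun ν hν => ?_
  have hdeg : ν.degree = n := by
    by_contra hne
    exact (mem_support_iff.1 hν) (hF.coeff_eq_zero hne)
  rw [← (linePoly_monomial v ν _).2, hdeg]

lemma coeff_one_linePoint (v : Fin 3 → A) :
    (fun i => (linePoint v i).coeff 1) = ![0, v 2, -v 1] := by
  ext i
  fin_cases i <;> simp [linePoint, Polynomial.coeff_C]

lemma eval_linePoint (v : Fin 3 → A) (t : A) :
    (fun i => (linePoint v i).eval t) = ![v 2, v 2 * t, -(v 0 + v 1 * t)] := by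
  ext i
  fin_cases i <;> simp [linePoint]

/-- The resultant of the restriction of a form of degree `n + 1` to a line and of its
derivative. -/
noncomputable def lineDiscr (n : ℕ) (v : Fin 3 → A) (F : MvPolynomial (Fin 3) A) : A :=
  (linePoly v F).resultant (linePoly v F).derivative (n + 1) n

variable {k : Type*} [Field k]

/-- The resultant is taken with fixed formal degrees, so it commutes with specialization and can be
computed for the generic member of the family. -/
lemma isPolyFun_lineDiscr {E : Type*} [AddCommGroup E] [Module k E] {n : ℕ}
    {v : E → Fin 3 → k} (hv : ∀ i, IsPolyFun fun x => v x i) {G : E → MvPolynomial (Fin 3) k}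
    (hG : IsPolyFam G) : IsPolyFun fun x => lineDiscr n (v x) (G x) := by
  obtain ⟨G', hG⟩ := hG
  choose V hV using hv
  refine ⟨lineDiscr n V G', fun x => ?_⟩
  change spec k x _ = _
  beta_reduce
  rw [lineDiscr, ← Polynomial.resultant_map_map, ← Polynomial.derivative_map, map_linePoly, hG,
    lineDiscr]
  rw [show (fun i => spec k x (V i)) = v x from funext fun i => hV i x]

/-- By Euler's relation both `l` and the gradient of `f` are orthogonal to `u`, so their cross
product is parallel to `u`; as `u 0 ≠ 0`, it vanishes with its coordinate of index `0`. -/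
lemma isSingularAt_linear_iff {l : Form k 1} {d : ℕ} {f : Form k d}
    {u : Fin 3 → k} (hu : u 0 ≠ 0) : IsSingularAt l.1 f.1 u ↔
      coeffs l ⬝ᵥ u = 0 ∧ eval u f.1 = 0 ∧
        coeffs l 2 * grad f.1 u 1 - coeffs l 1 * grad f.1 u 2 = 0 := by
  rw [isSingularAt_iff, eval_eq_dotProduct, grad_linear]
  refine and_congr_right fun h1 => and_congr_right fun h2 => ⟨fun h => ?_, fun h => ?_⟩
  · have := congrFun h 0
    simp only [cross_apply, Matrix.cons_val_zero, Pi.zero_apply] at this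
    linear_combination -this
  · have h3 : grad f.1 u ⬝ᵥ u = 0 := by
      have := congrArg (eval u) (IsHomogeneous.sum_X_mul_pderiv f.2)
      rw [map_nsmul, h2, smul_zero, map_sum] at this
      rw [← this]
      exact Finset.sum_congr rfl fun i _ => by rw [map_mul, eval_X, mul_comm]; rfl
    have h4 := mul_eq_mul_of_cross_eq_zero (cross_cross_eq_zero h1 h3)
    ext j
    have h5 := h4 0 j
    rw [show crossProduct (coeffs l) (grad f.1 u) 0 = 0 by
      simp only [cross_apply, Matrix.cons_val_zero]
      linear_combination -h, mul_zero] at h5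
    exact (mul_eq_zero.1 h5).resolve_left hu

/-- Away from the zeros of the leading coefficient, the discriminant detects the forms whose
restriction to the line is singular. -/
lemma lineDiscr_eq_zero_iff [IsAlgClosed k] {l : Form k 1} {d : ℕ} {f : Form k (d + 2)}
    (h : coeffs l 2 * eval ![0, coeffs l 2, -coeffs l 1] f.1 ≠ 0) :
    lineDiscr (d + 1) (coeffs l) f.1 = 0 ↔ IsSingularPair l.1 f.1 := by
  set v := coeffs l
  set p := linePoly v f.1
  have hv : v 2 ≠ 0 := left_ne_zero_of_mul h
  have hlead : p.coeff (d + 2) ≠ 0 := by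
    rw [coeff_linePoly v f.2, coeff_one_linePoint]
    exact right_ne_zero_of_mul h
  have hdeg : p.natDegree = d + 2 :=
    le_antisymm (natDegree_linePoly_le v f.2) (Polynomial.le_natDegree_of_ne_zero hlead)
  have hp0 : p ≠ 0 := by
    intro h0
    rw [h0, Polynomial.coeff_zero] at hlead
    exact hlead rfl
  -- The degree of the derivative drops if the characteristic divides `d + 2`. The formal resultant
  -- then differs from the actual one by a power of the leading coefficient, which is nonzero.
  obtain ⟨e, he⟩ : ∃ e, d + 1 = p.derivative.natDegree + e :=
    Nat.exists_eq_add_of_le (by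
      have := p.natDegree_derivative_le
      omega)
  have hres : lineDiscr (d + 1) v f.1 = p.coeff (d + 2) ^ e * p.resultant p.derivative :=
    calc lineDiscr (d + 1) v f.1
        = p.resultant p.derivative (d + 2) (p.derivative.natDegree + e) := by rw [← he]; rfl
      _ = _ := Polynomial.resultant_add_right_deg _ _ _ _ _ le_rfl
      _ = _ := by rw [hdeg]
  have h1 : lineDiscr (d + 1) v f.1 = 0 ↔ ¬ IsCoprime p p.derivative := by
    rw [hres, mul_eq_zero, or_iff_right (pow_ne_zero _ hlead), Polynomial.resultant_eq_zero_iff,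
      and_iff_right (Or.inl hp0)]
  have h2 : ∀ t : k, p.eval t = 0 ∧ p.derivative.eval t = 0 ↔
      IsSingularAt l.1 f.1 ![v 2, v 2 * t, -(v 0 + v 1 * t)] := by
    intro t
    rw [isSingularAt_linear_iff (by simpa using hv), derivative_linePoly, Polynomial.eval_sub,
      Polynomial.eval_mul, Polynomial.eval_mul, Polynomial.eval_C, Polynomial.eval_C, eval_linePoly,
      eval_linePoly, eval_linePoly, eval_linePoint]
    refine (and_iff_right ?_).symm
    simp [dotProduct, Fin.sum_univ_three, v]
    ring
  rw [h1, Polynomial.isCoprime_iff_aeval_ne_zero_of_isAlgClosed k k]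
  push Not
  simp only [Polynomial.coe_aeval_eq_eval]
  constructor
  · rintro ⟨t, ht⟩
    exact ⟨_, fun h0 => hv (congrFun h0 0), (h2 t).1 ht⟩
  · rintro ⟨u, hu, hs⟩
    have hlu : v 0 * u 0 + v 1 * u 1 + v 2 * u 2 = 0 := by
      have := hs.1
      rwa [eval_eq_dotProduct, dotProduct, Fin.sum_univ_three] at this
    -- The only point of the line with `u 0 = 0` is `(0, v 2, -v 1)`, where `f` does not vanish:
    -- every singular point lies in the chart.
    have hu0 : u 0 ≠ 0 := by
      intro hu0
      have e1 : u = (u 1 / v 2) • ![0, v 2, -v 1] := by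
        ext i
        fin_cases i
        · simpa using hu0
        · simp [hv]
        · simp
          field_simp
          linear_combination hlu - v 0 * hu0
      have hf := hs.2.1
      rw [e1, eval_smul_of_isHomogeneous f.2] at hf
      have h3 := eq_zero_of_pow_eq_zero ((mul_eq_zero.1 hf).resolve_right (right_ne_zero_of_mul h))
      rw [h3, zero_smul] at e1
      exact hu e1
    refine ⟨u 1 / u 0, (h2 _).2 ?_⟩
    convert isSingularAt_smul hs (v 2 / u 0) using 1
    ext i
    fin_cases i
    · simp [hu0]
    · simp
      field_simp
    · simp
      field_simp
      linear_combination -hlu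

end Discriminant

/-! ### Codimension -/

section Topology

variable {X : Type*} [TopologicalSpace X]

lemma hasCodim_one [IrreducibleSpace X] {Z : Set X} (hZ : IsIrreducible Z) (hc : IsClosed Z)
    (hne : Z ≠ Set.univ)
    (hmax : ∀ T : Set X, IsIrreducible T → IsClosed T → Z ⊂ T → T = Set.univ) :
    HasCodim Z 1 := by
  let W : TopologicalSpace.IrreducibleCloseds X := ⟨Z, hZ, hc⟩
  let U : TopologicalSpace.IrreducibleCloseds X :=
    ⟨Set.univ, IrreducibleSpace.isIrreducible_univ X, isClosed_univ⟩
  refine ⟨W, rfl, le_antisymm ?_ ?_⟩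
  · refine (Order.coheight_le_coe_iff (n := 1)).2 fun T hT => ?_
    have hTU : (T : Set X) = Set.univ := hmax _ T.isIrreducible T.isClosed hT
    have : Order.coheight T = 0 := Order.coheight_eq_zero.2 fun T' _ =>
      show (T' : Set X) ⊆ T from hTU ▸ Set.subset_univ _
    rw [this]
    exact Nat.cast_lt.2 one_pos
  · have hWU : W < U := show Z ⊂ Set.univ from Set.ssubset_univ_iff.2 hne
    exact le_trans (by simp) (Order.coheight_add_one_le hWU)

/-- An irreducible subset of the union of two closed sets lies in one of them; as neither contains
the other, both are maximal. -/
lemma image_irreducibleComponents_union {A B : Set X} (hA : IsIrreducible A)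
    (hB : IsIrreducible B) (hA' : IsClosed A) (hB' : IsClosed B) (hAB : ¬ A ⊆ B) (hBA : ¬ B ⊆ A) :
    (fun Z : Set ↥(A ∪ B) => Subtype.val '' Z) '' irreducibleComponents ↥(A ∪ B) = {A, B} := by
  have hsub : ∀ {Z : Set ↥(A ∪ B)}, IsIrreducible Z →
      Subtype.val '' Z ⊆ A ∨ Subtype.val '' Z ⊆ B := fun {Z} hZ => by
    refine isPreirreducible_iff_isClosed_union_isClosed.1
      (hZ.image _ continuous_subtype_val.continuousOn).isPreirreducible A B hA' hB' ?_
    rintro _ ⟨z, -, rfl⟩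
    exact z.2
  have hirr : ∀ {C : Set X}, IsIrreducible C → ∀ h : C ⊆ A ∪ B,
      IsIrreducible (Subtype.val ⁻¹' C : Set ↥(A ∪ B)) := fun {C} hC h => by
    have := Subtype.irreducibleSpace hC
    have h2 := (IrreducibleSpace.isIrreducible_univ C).image _
      (continuous_inclusion h).continuousOn
    rw [Set.image_univ, Set.range_inclusion] at h2
    exact h2
  have hmem : ∀ {C C' : Set X}, IsIrreducible C → ¬ C ⊆ C' → C ⊆ A ∪ B →
      (∀ {Z : Set ↥(A ∪ B)}, IsIrreducible Z → Subtype.val '' Z ⊆ C ∨ Subtype.val '' Z ⊆ C') →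
      (Subtype.val ⁻¹' C : Set ↥(A ∪ B)) ∈ irreducibleComponents ↥(A ∪ B) := by
    intro C C' hC hCC' h hs
    refine ⟨hirr hC h, fun Z hZ hle => ?_⟩
    rcases hs hZ with h1 | h1
    · exact Set.image_subset_iff.1 h1
    · exact absurd (fun x hx => h1 ⟨⟨x, h hx⟩, hle hx, rfl⟩) hCC'
  have himg : ∀ {C : Set X}, C ⊆ A ∪ B →
      Subtype.val '' (Subtype.val ⁻¹' C : Set ↥(A ∪ B)) = C := fun h => by
    rw [Subtype.image_preimage_coe, Set.inter_eq_right.2 h]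
  refine Set.Subset.antisymm ?_ ?_
  · rintro _ ⟨Z, hZ, rfl⟩
    have hmax : ∀ {C : Set X}, IsIrreducible C → C ⊆ A ∪ B → Subtype.val '' Z ⊆ C →
        Subtype.val '' Z = C := fun hC h hZC => by
      have := hZ.eq_of_subset (hirr hC h) (Set.image_subset_iff.1 hZC)
      rw [this, himg h]
    exact (hsub hZ.1).imp (hmax hA Set.subset_union_left) (hmax hB Set.subset_union_right)
  · rintro _ (rfl | rfl)
    · exact ⟨_, hmem hA hAB Set.subset_union_left hsub, himg Set.subset_union_left⟩
    · exact ⟨_, hmem hB hBA Set.subset_union_right fun h => (hsub h).symm,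
        himg Set.subset_union_right⟩

end Topology

section Codimension

variable {k : Type*} [Field k] [IsAlgClosed k] {n : ℕ}

lemma Triples.irreducibleSpace [Nonempty (Triples k n)] : IrreducibleSpace (Triples k n) :=
  have : Infinite k := IsAlgClosed.instInfinite
  (Triples.isOpenEmbedding_val n).irreducibleSpace

/-- It suffices that `H` be cut out by one equation `R = 0` on an open set `s ≠ 0` which it meets.
The image need not have preimage `H`, which matters for `D2nod`. -/
lemma Triples.hasCodim_image_point (hn : 2 ≤ n) {H : Set (Aff k (TripleSpace k n))}
    (hH : IsIrreducible H) {s R : TripleSpace k n → k} (hs : IsPolyFun s) (hR : IsPolyFun R)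
    (hsR : ∀ t : Triples k n, s t.1 ≠ 0 → (t.val ∈ H ↔ R t.1 = 0))
    {w : Triples k n} (hw : w.val ∈ H) (hsw : s w.1 ≠ 0)
    (hcl : IsClosed (Triples.point '' (Triples.val ⁻¹' H)))
    (hne : Triples.point '' (Triples.val ⁻¹' H) ≠ Set.univ) :
    IsIrreducible (Triples.point '' (Triples.val ⁻¹' H)) ∧
      HasCodim (Triples.point '' (Triples.val ⁻¹' H)) 1 := by
  have : Nonempty (Triples k n) := ⟨w⟩
  have : IrreducibleSpace (Triples k n) := Triples.irreducibleSpace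
  have : IrreducibleSpace (PVnod k n) :=
    (Triples.point_surjective n).irreducibleSpace (Triples.continuous_point n)
  have hirr := (hH.preimage (Triples.isOpenEmbedding_val n) ⟨w.val, hw, ⟨w, rfl⟩⟩).image _
    (Triples.continuous_point n).continuousOn
  refine ⟨hirr, hasCodim_one hirr hcl hne fun T hT hTc hDT => ?_⟩
  obtain ⟨s₁, hs₁, hs₁0, hs₁w⟩ := exists_isPolyFun_of_notMem
    (Triples.isOpen_range_val (k := k) n).isClosed_compl (x := w.1) (fun h => h ⟨w, rfl⟩)
  by_contra hTne
  obtain ⟨x, hx⟩ := (Set.ne_univ_iff_exists_notMem T).1 hTne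
  obtain ⟨t₀, rfl⟩ := Triples.point_surjective n x
  -- This yields a nonzero polynomial `P` which vanishes on all the triples over `T`.
  have hopen : IsOpen (Triples.val '' (Triples.point ⁻¹' Tᶜ)) :=
    (Triples.isOpenEmbedding_val n).isOpenMap _
      (hTc.isOpen_compl.preimage (Triples.continuous_point n))
  obtain ⟨P, hP, hP0, hPt⟩ := exists_isPolyFun_of_notMem hopen.isClosed_compl (x := t₀.1)
    (fun h => h ⟨t₀, hx, rfl⟩)
  obtain ⟨Q, hQ, ⟨y, hyH, hyQ⟩, hQs, hPQ⟩ := exists_isPolyFun_hypersurface hH (hs.mul hs₁) hR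
    (fun x hx => by
      have hr : x ∈ Set.range (Triples.val : Triples k n → Aff k (TripleSpace k n)) := by
        by_contra hr
        exact right_ne_zero_of_mul hx (hs₁0 x hr)
      obtain ⟨t, rfl⟩ := hr
      exact hsR t (left_ne_zero_of_mul hx)) ⟨w.1, hw, mul_ne_zero hsw hs₁w⟩ hP ⟨_, hPt⟩
  obtain ⟨t₁, rfl⟩ : y ∈ Set.range (Triples.val : Triples k n → Aff k (TripleSpace k n)) := by
    by_contra hr
    exact right_ne_zero_of_mul (hQs _ hyQ) (hs₁0 y hr)
  have hU : IsOpen (Triples.point '' {t : Triples k n | Q t.1 ≠ 0}) :=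
    Triples.isOpenMap_point hn _ (hQ.isOpen.preimage (Triples.continuous_val n))
  -- The open set `U` meets `T`, so `T` is contained in the closure of `T ∩ U`. Above a point of `T
  -- ∩ U` there is a triple with `P = 0` and `Q ≠ 0`, which therefore belongs to `H`.
  have hsub := subset_closure_inter_of_isPreirreducible_of_isOpen hT.isPreirreducible hU
    ⟨_, hDT.subset ⟨t₁, hyH, rfl⟩, t₁, hyQ, rfl⟩
  refine hDT.not_subset (hsub.trans (closure_minimal ?_ hcl))
  rintro _ ⟨ht, t, hQt, rfl⟩
  refine ⟨t, hPQ _ (hP0 _ ?_) hQt, rfl⟩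
  rintro ⟨t', ht', h⟩
  rw [Triples.val_injective n h] at ht'
  exact ht' ht

end Codimension

/-! ### Examples of triples -/

section Examples

variable {k : Type*} [Field k]

/-- The linear form given by a variable. -/
noncomputable def varForm (k : Type*) [Field k] (i : Fin 3) : Form k 1 := ⟨X i, isHomogeneous_X k i⟩

@[simp] lemma coe_varForm (i : Fin 3) : (varForm k i).1 = X i := rfl

lemma coeffs_varForm (i : Fin 3) : coeffs (varForm k i) = Pi.single i 1 := by
  have h : varForm k i = ofCoeffs (Pi.single i 1) := Subtype.ext (by
    simp [ofCoeffs, Pi.single_apply, apply_ite, ite_mul])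
  rw [h, coeffs_ofCoeffs]

lemma linearIndependent_varForm {i j : Fin 3} (h : i ≠ j) :
    LinearIndependent k ![varForm k i, varForm k j] := by
  rw [linearIndependent_iff_cross, coeffs_varForm, coeffs_varForm]
  intro h0
  have := fun l => congrFun h0 l
  fin_cases i <;> fin_cases j <;> simp [cross_apply, Fin.forall_fin_succ] at h this

/-- The binary form `z ^ (d + 1) + a z s ^ d + s ^ (d + 1)`, where `a` is chosen such that its
discriminant is nonzero. -/
noncomputable def reducedForm (d : ℕ) (s z : MvPolynomial (Fin 3) k) : MvPolynomial (Fin 3) k :=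
  open scoped Classical in
  z ^ (d + 1) + C (if (d + 1 : k) = 0 then 1 else 0) * z * s ^ d + s ^ (d + 1)

/-- With `s = X j` and `z = X l`, a singular point would kill both partial derivatives of the binary
form. If `s = 0`, the derivative in `s` gives `z = 0`. Otherwise the derivative in `z` gives `(d +
1) z ^ d + a s ^ d = 0`: for `d + 1 = 0` in `k` this reads `s ^ d = 0`, and else `z ^ d = 0`, whence
`s ^ (d + 1) = 0`. -/
lemma not_isSingularPair_reducedForm {i j l : Fin 3} (hij : i ≠ j) (hil : i ≠ l) (hjl : j ≠ l)
    (d : ℕ) (e : MvPolynomial (Fin 3) k) :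
    ¬ IsSingularPair (X i) (X j * reducedForm d (X j) (X l) + X i * e) := by
  intro h
  have h := h.smul_add 1 1 (-e)
  rw [C_1, one_mul, one_mul, show X j * reducedForm d (X j) (X l) + X i * e + -e * X i =
    X j * reducedForm d (X j) (X l) by ring] at h
  obtain ⟨u, hu, h1, h2, h3⟩ := h
  obtain ⟨-, -, h3⟩ := isSingularAt_iff.1 ⟨h1, h2, h3⟩
  have hcross := mul_eq_mul_of_cross_eq_zero h3
  rw [eval_X] at h1
  rw [map_mul, eval_X] at h2
  have hj := hcross i j
  have hl := hcross i l
  simp only [grad, pderiv_X, reducedForm, Derivation.leibniz, Derivation.leibniz_pow, map_add,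
    Pi.single_apply, hij, hil, hjl, hij.symm, hil.symm, hjl.symm, pderiv_C, smul_eq_mul, map_mul,
    if_true, if_false, map_one, map_zero, mul_zero, zero_add, add_zero, mul_one, one_mul, eval_X,
    map_pow, eval_C, nsmul_eq_mul, map_natCast, Nat.cast_add, Nat.cast_one,
    Nat.add_sub_cancel] at hj hl h2
  by_cases hs : u j = 0
  · rw [hs] at hj
    have hl0 : u l = 0 := by
      rcases Nat.eq_zero_or_pos d with rfl | hd
      · simpa using hj
      · simpa [hd.ne'] using hj
    refine hu (funext fun x => ?_)
    have hx : x = i ∨ x = j ∨ x = l := by omega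
    rcases hx with rfl | rfl | rfl
    exacts [h1, hs, hl0]
  · have h4 := (mul_eq_zero.1 hl).resolve_left hs
    have h5 := (mul_eq_zero.1 h2).resolve_left hs
    by_cases hd : (d + 1 : k) = 0
    · rw [hd, if_pos rfl, zero_mul, zero_add, mul_one] at h4
      exact pow_ne_zero _ hs h4
    · rw [if_neg hd, mul_zero, add_zero] at h4
      have h6 := (mul_eq_zero.1 h4).resolve_left hd
      rw [if_neg hd, pow_succ, h6, zero_mul, zero_mul, zero_add, zero_add] at h5
      exact pow_ne_zero _ hs h5

lemma X_mul_reducedForm_mem (i j : Fin 3) (d : ℕ) :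
    (X i * reducedForm d (X i) (X j) : MvPolynomial (Fin 3) k) ∈ Form k (d + 2) := by
  have h : ∀ i : Fin 3, ∀ e, ((X i : MvPolynomial (Fin 3) k) ^ e).IsHomogeneous e := fun i e => by
    simpa using (isHomogeneous_X k i).pow e
  have h2 : (reducedForm d (X i) (X j) : MvPolynomial (Fin 3) k).IsHomogeneous (d + 1) := by
    refine ((h _ _).add ?_).add (h _ _)
    rw [add_comm d 1, ← zero_add 1]
    exact ((isHomogeneous_C (Fin 3) _).mul (isHomogeneous_X k j)).mul (h i d)
  have := (isHomogeneous_X k i).mul h2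
  rwa [show 1 + (d + 1) = d + 2 by ring] at this

lemma notMem_multiples_prodForm {n : ℕ} {l m : Form k 1} {f : Form k n} {u : Fin 3 → k}
    (hl : eval u l.1 = 0) (hf : eval u f.1 ≠ 0) : f ∉ multiples n (prodForm l m) := by
  rintro h
  obtain ⟨g, hg⟩ := mem_multiples.1 h
  refine hf ?_
  rw [← hg]
  simp [hl]

/-- A triple of two lines and of a curve which passes through their intersection and is
transverse to both lines elsewhere. -/
noncomputable def nodeTriple (k : Type*) [Field k] (d : ℕ) : Triples k (d + 2) :=
  ⟨(varForm k 0, varForm k 1, ⟨X 1 * reducedForm d (X 1) (X 2) + X 0 * reducedForm d (X 0) (X 2),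
    Submodule.add_mem _ (X_mul_reducedForm_mem _ _ _) (X_mul_reducedForm_mem _ _ _)⟩),
    linearIndependent_varForm (by decide),
    notMem_multiples_prodForm (u := ![0, 1, 0]) (by simp)
      (by simp [reducedForm, apply_ite (eval _)])⟩

lemma nodeTriple_mem_D1nod (d : ℕ) : (nodeTriple k d).point ∈ D1nod k (d + 2) :=
  (Triples.point_mem_D1nod_iff _).2
    ⟨![0, 0, 1], fun h => one_ne_zero (congrFun h 2), by simp [nodeTriple], by simp [nodeTriple],
      by simp [nodeTriple]⟩

lemma nodeTriple_notMem_D2nod (d : ℕ) : (nodeTriple k d).point ∉ D2nod k (d + 2) := by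
  rw [Triples.point_mem_D2nod_iff]
  rintro (h | h)
  · exact not_isSingularPair_reducedForm (by decide) (by decide) (by decide) d _ h
  · have h' : IsSingularPair (X 1) (X 1 * reducedForm d (X 1) (X 2) +
      X 0 * reducedForm d (X 0) (X 2) : MvPolynomial (Fin 3) k) := h
    rw [add_comm] at h'
    exact not_isSingularPair_reducedForm (by decide) (by decide) (by decide) d _ h'

/-- A triple of two lines and of a multiple line which is not concurrent with them. -/
noncomputable def tangentTriple (k : Type*) [Field k] (d : ℕ) : Triples k (d + 2) :=
  ⟨(varForm k 2, varForm k 0, ⟨X 1 ^ (d + 2), by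
    simpa using (isHomogeneous_X k (1 : Fin 3)).pow (d + 2)⟩),
    linearIndependent_varForm (by decide),
    notMem_multiples_prodForm (u := ![0, 1, 0]) (by simp) (by simp)⟩

lemma tangentTriple_mem_tangentLocus (d : ℕ) : (tangentTriple k d).val ∈ tangentLocus k d :=
  ⟨varForm k 1, ⟨X 1 ^ d, by simpa using (isHomogeneous_X k (1 : Fin 3)).pow d⟩, 0, by
    change (X 1 ^ (d + 2) : MvPolynomial (Fin 3) k) = X 1 ^ 2 * X 1 ^ d + X 2 * 0
    ring⟩

lemma tangentTriple_notMem_D1nod (d : ℕ) : (tangentTriple k d).point ∉ D1nod k (d + 2) := by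
  rw [Triples.point_mem_D1nod_iff]
  rintro ⟨u, hu, h1, h2, h3⟩
  refine hu (funext fun i => ?_)
  fin_cases i
  · simpa [tangentTriple] using h2
  · simpa [tangentTriple] using h3
  · simpa [tangentTriple] using h1

lemma tangentTriple_mem_D2nod (d : ℕ) : (tangentTriple k d).point ∈ D2nod k (d + 2) :=
  D2nod_eq_image (k := k) d ▸ ⟨_, tangentTriple_mem_tangentLocus d, rfl⟩

lemma D1nod_not_subset (d : ℕ) : ¬ D1nod k (d + 2) ⊆ D2nod k (d + 2) := fun h =>
  nodeTriple_notMem_D2nod d (h (nodeTriple_mem_D1nod (k := k) d))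

lemma D2nod_not_subset (d : ℕ) : ¬ D2nod k (d + 2) ⊆ D1nod k (d + 2) := fun h =>
  tangentTriple_notMem_D1nod d (h (tangentTriple_mem_D2nod (k := k) d))

end Examples

/-! ### Irreducibility and codimension of the two loci -/

section Components

variable {k : Type*} [Field k] [IsAlgClosed k]

lemma hasCodim_D1nod (d : ℕ) :
    IsIrreducible (D1nod k (d + 2)) ∧ HasCodim (D1nod k (d + 2)) 1 := by
  have : Infinite k := IsAlgClosed.instInfinite
  have hc := isClosed_D1nod (k := k) d
  have hne : D1nod k (d + 2) ≠ Set.univ := fun h =>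
    tangentTriple_notMem_D1nod (k := k) d (h ▸ Set.mem_univ _)
  have hw := (Triples.point_mem_D1nod_iff' _).1 (nodeTriple_mem_D1nod (k := k) d)
  rw [D1nod_eq_image] at hc hne ⊢
  exact Triples.hasCodim_image_point (by omega) (isIrreducible_nodeLocus d) (IsPolyFun.const 1)
    (IsPolyFam.eval (IsPolyFam.of_linear (trdForm (k := k) (d + 2)))
      (isPolyFun_cross (fstForm (d + 2)) (sndForm (d + 2))))
    (fun t _ => t.val_mem_nodeLocus_iff) hw one_ne_zero hc hne

lemma hasCodim_D2nod (d : ℕ) :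
    IsIrreducible (D2nod k (d + 2)) ∧ HasCodim (D2nod k (d + 2)) 1 := by
  have : Infinite k := IsAlgClosed.instInfinite
  have hc := isClosed_D2nod (k := k) (n := d + 2) (by omega)
  have hne : D2nod k (d + 2) ≠ Set.univ := fun h =>
    nodeTriple_notMem_D2nod (k := k) d (h ▸ Set.mem_univ _)
  rw [D2nod_eq_image] at hc hne ⊢
  have hl := isPolyFun_coeffs (fstForm (k := k) (d + 2))
  have hF := IsPolyFam.of_linear (trdForm (k := k) (d + 2))
  have hu : ∀ i, IsPolyFun fun t : TripleSpace k (d + 2) =>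
      (![0, coeffs t.1 2, -coeffs t.1 1] : Fin 3 → k) i := by
    intro i
    fin_cases i
    exacts [IsPolyFun.const 0, hl 2, (hl 1).neg]
  refine Triples.hasCodim_image_point (by omega) (isIrreducible_tangentLocus d)
    ((hl 2).mul (hF.eval hu)) (isPolyFun_lineDiscr (n := d + 1) hl hF)
    (fun t ht => t.val_mem_tangentLocus_iff.trans (lineDiscr_eq_zero_iff ht).symm)
    (tangentTriple_mem_tangentLocus d) ?_ hc hne
  -- The first line of the example is `X 2 = 0`, so its last coefficient is `1`, and `X 1 ^ (d + 2)`
  -- takes the value `1` at `(0, 1, 0)`.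
  simp [tangentTriple, fstForm, trdForm, coeffs_varForm]

end Components

/-! ### Invariance -/

section Invariance

variable {k : Type*} [Field k]

lemma eval_mulVec_subst (A : GL (Fin 3) k) (u : Fin 3 → k) (f : MvPolynomial (Fin 3) k) :
    eval (A.1 *ᵥ u) (subst A f) = eval u f := by
  have h : ((aeval (A.1 *ᵥ u)).comp (subst A) : MvPolynomial (Fin 3) k →ₐ[k] k) = aeval u := by
    ext i
    have h2 : (A⁻¹ : GL (Fin 3) k).1 *ᵥ (A.1 *ᵥ u) = u := by
      rw [Matrix.mulVec_mulVec, ← Units.val_mul, inv_mul_cancel, Units.val_one, Matrix.one_mulVec]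
    have h3 := congrFun h2 i
    simpa [subst, Matrix.mulVec, dotProduct] using h3
  exact congrArg (fun φ => φ f) h

lemma actQuad_eq_mul (A : GL (Fin 3) k) {q : Form k 2} {l m : Form k 1} (h : q.1 = l.1 * m.1) :
    (actQuad A q).1 = (A.1.det • substForm A 1 l).1 * (substForm A 1 m).1 := by
  simp [actQuad, h]

lemma smul_mem_D1nod {n : ℕ} (A : GL (Fin 3) k) {x : PVnod k n} (hx : x ∈ D1nod k n) :
    A • x ∈ D1nod k n := by
  obtain ⟨p, hp, l, m, hlm, u, hu, h1, h2, h3⟩ := hx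
  refine ⟨A • p, congrArg (A • ·) hp, _, _, actQuad_eq_mul A hlm, A.1 *ᵥ u, ?_, ?_, ?_, ?_⟩
  · intro h
    exact hu (Matrix.mulVec_injective_of_isUnit A.isUnit (h.trans (Matrix.mulVec_zero _).symm))
  · simp [smul_eval, eval_mulVec_subst, h1]
  · exact (eval_mulVec_subst A u _).trans h2
  · exact (eval_mulVec_subst A u _).trans h3

/-- The decomposition `f = m² g + l h` is carried along by any substitution, which avoids the chain
rule for gradients. The scalar `c` accommodates the determinant in `actQuad`. -/
lemma IsSingularPair.substForm {l : Form k 1} (hl : l ≠ 0) {d : ℕ} {f : Form k (d + 2)}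
    (h : IsSingularPair l.1 f.1) (A : GL (Fin 3) k) (c : k) :
    IsSingularPair (c • substForm A 1 l).1 (substForm A (d + 2) f).1 := by
  obtain ⟨m, g, e, hf⟩ := (isSingularPair_linear_iff hl f).1 h
  have hl' : TernaryForms.substForm A 1 l ≠ 0 := fun h =>
    hl (substForm_injective A 1 (h.trans (map_zero _).symm))
  have h' := (isSingularPair_linear_iff hl' (TernaryForms.substForm A (d + 2) f)).2
    ⟨TernaryForms.substForm A 1 m, TernaryForms.substForm A d g,
      TernaryForms.substForm A (d + 1) e, by simp [hf]⟩
  have h2 := h'.smul_add c 1 0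
  rw [C_1, one_mul, zero_mul, add_zero, ← smul_eq_C_mul] at h2
  exact h2

lemma smul_mem_D2nod {d : ℕ} (A : GL (Fin 3) k) {x : PVnod k (d + 2)}
    (hx : x ∈ D2nod k (d + 2)) : A • x ∈ D2nod k (d + 2) := by
  obtain ⟨p, hp, l, m, hlm, h⟩ := hx
  have hlm0 : l.1 * m.1 ≠ 0 := fun h0 => p.2.1 (Subtype.ext (hlm.trans h0))
  have hl : l ≠ 0 := by
    rintro rfl
    exact hlm0 (zero_mul _)
  have hm : m ≠ 0 := by
    rintro rfl
    exact hlm0 (mul_zero _)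
  refine ⟨A • p, congrArg (A • ·) hp, _, _, actQuad_eq_mul A hlm, ?_⟩
  refine h.imp (fun h => h.substForm hl A _) fun h => ?_
  have h2 := h.substForm hm A 1
  rw [one_smul] at h2
  exact h2

end Invariance

end TernaryForms

theorem proposition3p5 {k : Type*} [Field k] [IsAlgClosed k] (n : ℕ) (hn : 2 ≤ n) :
    IsClosed (TernaryForms.Dnod k n) ∧
    (fun Z : Set (TernaryForms.Dnod k n) => Subtype.val '' Z) ''
        irreducibleComponents (TernaryForms.Dnod k n) =
      {TernaryForms.D1nod k n, TernaryForms.D2nod k n} ∧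
    TernaryForms.D1nod k n ≠ TernaryForms.D2nod k n ∧
    (∀ (A : Matrix.GeneralLinearGroup (Fin 3) k), ∀ x ∈ TernaryForms.D1nod k n,
      A • x ∈ TernaryForms.D1nod k n) ∧
    (∀ (A : Matrix.GeneralLinearGroup (Fin 3) k), ∀ x ∈ TernaryForms.D2nod k n,
      A • x ∈ TernaryForms.D2nod k n) ∧
    TernaryForms.HasCodim (TernaryForms.D1nod k n) 1 ∧
    TernaryForms.HasCodim (TernaryForms.D2nod k n) 1 := by
  obtain ⟨d, rfl⟩ := Nat.exists_eq_add_of_le' hn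
  have h1 := TernaryForms.hasCodim_D1nod (k := k) d
  have h2 := TernaryForms.hasCodim_D2nod (k := k) d
  have hc1 := TernaryForms.isClosed_D1nod (k := k) d
  have hc2 := TernaryForms.isClosed_D2nod (k := k) hn
  refine ⟨?_, ?_, fun h => TernaryForms.D1nod_not_subset (k := k) d h.subset,
    fun A x hx => TernaryForms.smul_mem_D1nod A hx,
    fun A x hx => TernaryForms.smul_mem_D2nod A hx, h1.2, h2.2⟩
  · rw [TernaryForms.Dnod_eq_union]
    exact hc1.union hc2
  · rw [TernaryForms.Dnod_eq_union]
    exact TernaryForms.image_irreducibleComponents_union h1.1 h2.1 hc1 hc2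
      (TernaryForms.D1nod_not_subset d) (TernaryForms.D2nod_not_subset d)
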